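/- All graphs are finite and loopless; multiple edges are allowed. Let $m\ge 1$ be an integer. For a graph $G$ and $S\subseteq V(G)$, let $\omega(G)$ be the number of connected components of $G$ and let $G\setminus S$ be the graph obtained from $G$ by deleting the vertices of $S$. A graph is *$m$-tree-connected* if it has $m$ pairwise edge-disjoint spanning trees (a one-vertex graph is $m$-tree-connected, the graph without vertices is not). The *$m$-tree-connected components* of $G$ are its maximal induced $m$-tree-connected subgraphs; their vertex sets form a partition $P$ of $V(G)$, and $$\Omega_m(G)=|P|-\frac1m\,e_G(P),$$ where $e_G(P)$ is the number of edges of $G$ whose ends lie in different parts of $P$. For a real number $t>0$, a graph $G$ is *$t$-tough* if $\omega(G\setminus S)\le\max\{1,|S|/t\}$ for all $S\subseteq V(G)$, and *$m$-strongly $t$-tough* if $\Omega_m(G\setminus S)\le\max\{1,|S|/t\}$ for all $S\subseteq V(G)$. **Theorem.** Let $m\ge 1$ be an integer and let $G$ be an $(m^2+m-1)$-tough graph. 1. If $|V(G)|\ge (m^2+3m+2)/2$, then $G$ is $m$-strongly $m$-tough, that is, $\Omega_m(G\setminus S)\le\max\{1,|S|/m\}$ for all $S\subseteq V(G)$. 2.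 If $|V(G)|\ge 2m$, then $G$ has an $m$-tree-connected spanning subgraph $H$ with maximum degree $\Delta(H)\le 2m+1$. -/

import Mathlib

/-!
Finite loopless multigraphs are Mathlib's `Graph α β` (vertices in `α`, edges in `β`).
-/

namespace Graph

variable {α β : Type*}

/-- There is a walk from `x` to `y` in `G`. -/
def Reachable (G : Graph α β) (x y : α) : Prop :=
  Relation.ReflTransGen G.Adj x y

/-- `G` is nonnull and any two of its vertices are joined by a walk. -/
def Connected (G : Graph α β) : Prop :=
  V(G).Nonempty ∧ ∀ x ∈ V(G), ∀ y ∈ V(G), G.Reachable x y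

/-- `G` has no cycle: no edge `e` lies on a cycle, that is, the ends of `e` are not joined by a
walk that avoids `e` (in particular there are no loops and no parallel edges). -/
def IsAcyclic (G : Graph α β) : Prop :=
  ∀ e x y, G.IsLink e x y → ¬ (G.deleteEdges {e}).Reachable x y

/-- A tree is a connected graph without cycles. -/
def IsTree (G : Graph α β) : Prop :=
  G.Connected ∧ G.IsAcyclic

/-- The vertex sets of the connected components of `G`. -/
def componentSets (G : Graph α β) : Set (Set α) :=
  {C | ∃ x ∈ V(G), C = {y | y ∈ V(G) ∧ G.Reachable x y}}

/-- `ω(G)`, the number of components of `G`. -/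
noncomputable def numComponents (G : Graph α β) : ℕ :=
  G.componentSets.ncard

/-- `G` is `m`-tree-connected: it has `m` pairwise edge-disjoint spanning trees. The trees are
indexed, so that a one-vertex graph, whose spanning tree has no edges, is `m`-tree-connected. -/
def IsTreeConnected (m : ℕ) (G : Graph α β) : Prop :=
  ∃ T : Fin m → Graph α β, (∀ i, T i ≤s G ∧ (T i).IsTree) ∧
    Pairwise fun i j => Disjoint E(T i) E(T j)

/-- The partition of `V(G)` into the vertex sets of the `m`-tree-connected components of `G`,
which are the maximal induced `m`-tree-connected subgraphs of `G`. -/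
def treeComponentSets (m : ℕ) (G : Graph α β) : Set (Set α) :=
  {X | Maximal (fun Y : Set α => Y ⊆ V(G) ∧ IsTreeConnected m (G.induce Y)) X}

/-- The edges of `G` whose ends lie in different parts of `P`. -/
def crossingEdges (G : Graph α β) (P : Set (Set α)) : Set β :=
  {e | ∃ x y, G.IsLink e x y ∧ ∃ A ∈ P, ∃ B ∈ P, A ≠ B ∧ x ∈ A ∧ y ∈ B}

/-- `Ω_m(G) = |P| - e_G(P) / m`, where `P` is the partition of `V(G)` into the vertex sets of the
`m`-tree-connected components of `G`. -/
noncomputable def Omega (m : ℕ) (G : Graph α β) : ℝ :=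
  ((treeComponentSets m G).ncard : ℝ)
    - (1 / (m : ℝ)) * ((G.crossingEdges (treeComponentSets m G)).ncard : ℝ)

/-- `G` is `t`-tough: `ω(G ∖ S) ≤ max {1, |S| / t}` for all `S ⊆ V(G)`. -/
def IsTough (t : ℝ) (G : Graph α β) : Prop :=
  ∀ S : Set α, S ⊆ V(G) →
    ((G.deleteVerts S).numComponents : ℝ) ≤ max 1 ((1 / t) * (S.ncard : ℝ))

/-- `G` is `m`-strongly `t`-tough: `Ω_m(G ∖ S) ≤ max {1, |S| / t}` for all `S ⊆ V(G)`. -/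
def IsStronglyTough (m : ℕ) (t : ℝ) (G : Graph α β) : Prop :=
  ∀ S : Set α, S ⊆ V(G) →
    Omega m (G.deleteVerts S) ≤ max 1 ((1 / t) * (S.ncard : ℝ))

/-- The degree of `v`: the number of edges incident to `v` (`G` being loopless). -/
noncomputable def edgeDegree (G : Graph α β) (v : α) : ℕ :=
  (G.incidenceSet v).ncard

end Graph

/-! Let `I` be a maximal edge set with at most m(|X| - 1) edges inside every nonempty vertex set X,
and call X tight if equality holds. Tight sets that meet have tight unions and intersections. By the
theorem of Nash-Williams (`Sparse.exists_packing`) tight sets induce m-tree-connected subgraphs, and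
the maximal ones are the m-tree-connected components. Hence m Ω_m(G) = m|V| - |I| (`mul_Omega`),
where `I` may be any such sparse basis.

Strong toughness. Put t = m² + m - 1 and let d(A) be the number of edges that leave the component A
of G \ S. Then m Ω_m(G \ S) is the sum of m - d(A)/2 over all A. Since (m - d/2)(d + 1) ≤ t - d
(`sub_half_mul_le`), a weighted Caro-Wei bound yields a family J of pairwise nonadjacent components
with m Ω_m(G \ S) ≤ ∑_J (t - d(A)). If the left side exceeded |S|, then S and the outer ends of the
edges leaving J would be fewer than t|J| vertices that separate the members of J. This contradicts
toughness if |J| ≥ 2, and |J| = 1 would force |V| < 2t. A t-tough graph that is not complete has at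
least 2t + 2 vertices; for complete graphs a direct count uses the assumed lower bound on |V|.

Bounded degree. A complete graph with at least 2m vertices contains m disjoint Hamiltonian paths.
Any other G is m-strongly m-tough by the above, so `I` has m(|V| - 1) edges. Among all such bases,
take one, K, that minimizes the total excess of the degrees over 2m + 1. If some degree is too
large, exchange arguments (`IsBase.exists_deg_le_or_obstruction`) give a set S of vertices of degree
at least 2m + 1 such that K restricted to V \ S is a sparse basis of G \ S. Counting edges then
gives m Ω_m(G \ S) > |S| + 2m, against strong toughness. -/

section

/-! ### Connectivity as linear algebra over the rationals. -/

open scoped Classical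

namespace EdgeEnds

variable {α β : Type*} (a b : β → α)

/-- `x` and `y` are joined by a walk with edges in `F`, where `e` has the ends `a e` and `b e`. -/
def Conn (F : Set β) : α → α → Prop :=
  Relation.EqvGen fun x y => ∃ e ∈ F, a e = x ∧ b e = y

/-- The row of the oriented incidence matrix that belongs to `e`. -/
noncomputable def edgeVec (e : β) : α →₀ ℚ :=
  Finsupp.single (a e) 1 - Finsupp.single (b e) 1

/-- The span of the rows of the oriented incidence matrix that belong to `F`. -/
noncomputable def edgeSpan (F : Set β) : Submodule ℚ (α →₀ ℚ) :=
  Submodule.span ℚ (edgeVec a b '' F)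

variable {a b}

lemma Conn.refl (F : Set β) (x : α) : Conn a b F x x := Relation.EqvGen.refl x

lemma Conn.symm {F : Set β} {x y : α} (h : Conn a b F x y) : Conn a b F y x :=
  Relation.EqvGen.symm _ _ h

lemma Conn.trans {F : Set β} {x y z : α} (h : Conn a b F x y) (h' : Conn a b F y z) :
    Conn a b F x z :=
  Relation.EqvGen.trans _ _ _ h h'

lemma Conn.edge {F : Set β} {e : β} (he : e ∈ F) : Conn a b F (a e) (b e) :=
  Relation.EqvGen.rel _ _ ⟨e, he, rfl, rfl⟩

lemma Conn.mono {F F' : Set β} (h : F ⊆ F') {x y : α} (hc : Conn a b F x y) :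
    Conn a b F' x y :=
  Relation.EqvGen.mono (fun _ _ ⟨e, he, h1⟩ => ⟨e, h he, h1⟩) _ _ hc

/-- An equivalence relation that holds for the ends of every edge holds along walks. -/
lemma Conn.lift {F : Set β} {r : α → α → Prop} (hr : Equivalence r)
    (h : ∀ e ∈ F, r (a e) (b e)) {x y : α} (hc : Conn a b F x y) : r x y := by
  induction hc with
  | rel x y hxy => obtain ⟨e, he, rfl, rfl⟩ := hxy; exact h e he
  | refl x => exact hr.refl x
  | symm x y _ ih => exact hr.symm ih
  | trans x y z _ _ ih1 ih2 => exact hr.trans ih1 ih2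

lemma edgeVec_mem {F : Set β} {e : β} (he : e ∈ F) : edgeVec a b e ∈ edgeSpan a b F :=
  Submodule.subset_span ⟨e, he, rfl⟩

lemma edgeSpan_mono {F F' : Set β} (h : F ⊆ F') : edgeSpan a b F ≤ edgeSpan a b F' :=
  Submodule.span_mono (Set.image_mono h)

lemma edgeSpan_le {F : Set β} {W : Submodule ℚ (α →₀ ℚ)} (h : ∀ e ∈ F, edgeVec a b e ∈ W) :
    edgeSpan a b F ≤ W := by
  refine Submodule.span_le.2 ?_
  rintro _ ⟨e, he, rfl⟩
  exact h e he

/-- For the converse, the sum of the coefficients over the component of `x` is a functional that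
kills all edge vectors, but takes the value 1 on the difference if `y` lies in another component. -/
lemma conn_iff {F : Set β} {x y : α} :
    Conn a b F x y ↔ Finsupp.single x (1 : ℚ) - Finsupp.single y 1 ∈ edgeSpan a b F := by
  constructor
  · refine Conn.lift (r := fun x y =>
      Finsupp.single x (1 : ℚ) - Finsupp.single y 1 ∈ edgeSpan a b F) ⟨?_, ?_, ?_⟩ ?_
    · intro x; simp
    · intro x y h
      have := Submodule.neg_mem _ h
      rwa [neg_sub] at this
    · intro x y z h1 h2
      have := Submodule.add_mem _ h1 h2
      rwa [sub_add_sub_cancel] at this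
    · exact fun e he => edgeVec_mem he
  · intro h
    let φ : (α →₀ ℚ) →ₗ[ℚ] ℚ :=
      Finsupp.linearCombination ℚ fun z => if Conn a b F x z then (1 : ℚ) else 0
    have hφ : edgeSpan a b F ≤ LinearMap.ker φ := by
      refine edgeSpan_le fun e he => ?_
      have : Conn a b F x (a e) ↔ Conn a b F x (b e) :=
        ⟨fun h => h.trans (Conn.edge he), fun h => h.trans (Conn.edge he).symm⟩
      simp [φ, edgeVec, this]
    have h1 := hφ h
    by_contra hn
    simp [φ, hn, Conn.refl] at h1

instance (F : Finset β) : FiniteDimensional ℚ (edgeSpan a b (F : Set β)) :=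
  FiniteDimensional.span_of_finite ℚ (F.finite_toSet.image _)

lemma finrank_edgeSpan_le (F : Finset β) :
    Module.finrank ℚ (edgeSpan a b (F : Set β)) ≤ F.card := by
  have h := finrank_span_finset_le_card (R := ℚ) (F.image (edgeVec a b))
  rw [Finset.coe_image] at h
  exact h.trans Finset.card_image_le

/-- Adding the unit vector of a single vertex of `U` to the span of the edges yields the unit
vectors of all of `U`. -/
lemma card_le_of_conn {F : Finset β} {U : Finset α}
    (h : ∀ x ∈ U, ∀ y ∈ U, Conn a b F x y) :
    U.card ≤ Module.finrank ℚ (edgeSpan a b (F : Set β)) + 1 := by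
  rcases U.eq_empty_or_nonempty with rfl | ⟨x0, hx0⟩
  · simp
  have hU : Module.finrank ℚ (Submodule.span ℚ (U.image fun x => Finsupp.single x (1 : ℚ) :
      Set (α →₀ ℚ))) = U.card := by
    rw [finrank_span_finset_eq_card, Finset.card_image_of_injective]
    · exact Finsupp.single_left_injective one_ne_zero
    · rw [Finset.coe_image]
      exact ((Finsupp.linearIndependent_single_one ℚ α).linearIndepOn_id).mono
        (by rintro _ ⟨x, _, rfl⟩; exact ⟨x, rfl⟩)
  have hle : Submodule.span ℚ (U.image fun x => Finsupp.single x (1 : ℚ) : Set (α →₀ ℚ)) ≤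
      edgeSpan a b (F : Set β) ⊔ Submodule.span ℚ {Finsupp.single x0 (1 : ℚ)} := by
    rw [Submodule.span_le]
    intro v hv
    simp only [Finset.coe_image, Set.mem_image, Finset.mem_coe] at hv
    obtain ⟨x, hx, rfl⟩ := hv
    have h1 := conn_iff.1 (h x hx x0 hx0)
    rw [← sub_add_cancel (Finsupp.single x (1 : ℚ)) (Finsupp.single x0 1)]
    exact Submodule.add_mem_sup h1 (Submodule.mem_span_singleton_self _)
  calc U.card = _ := hU.symm
    _ ≤ _ := Submodule.finrank_mono hle
    _ ≤ _ := Submodule.finrank_add_le_finrank_add_finrank _ _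
    _ ≤ _ := by gcongr; exact (finrank_span_le_card _).trans (by simp)

lemma card_le_card_add_one_of_conn {F : Finset β} {U : Finset α}
    (h : ∀ x ∈ U, ∀ y ∈ U, Conn a b F x y) : U.card ≤ F.card + 1 :=
  (card_le_of_conn h).trans (by gcongr; exact finrank_edgeSpan_le F)

/-- The differences of the vectors that belong to `x` and to the vertices of `V`. -/
noncomputable def vertexSpan (V : Finset α) (x : α) : Submodule ℚ (α →₀ ℚ) :=
  Submodule.span ℚ (((V.erase x).image fun y => Finsupp.single x (1 : ℚ) - Finsupp.single y 1 :
    Finset (α →₀ ℚ)) : Set (α →₀ ℚ))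

lemma mem_vertexSpan {V : Finset α} (x : α) {y : α} (hy : y ∈ V) :
    Finsupp.single x (1 : ℚ) - Finsupp.single y 1 ∈ vertexSpan V x := by
  by_cases hxy : y = x
  · subst hxy; simp
  · exact Submodule.subset_span (Finset.mem_coe.2 (Finset.mem_image.2
      ⟨y, Finset.mem_erase.2 ⟨hxy, hy⟩, rfl⟩))

lemma finrank_vertexSpan_lt {V : Finset α} {x : α} (hx : x ∈ V) :
    Module.finrank ℚ (vertexSpan V x) < V.card := by
  refine ((finrank_span_finset_le_card _).trans Finset.card_image_le).trans_lt ?_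
  exact Finset.card_erase_lt_of_mem hx

instance (V : Finset α) (x : α) : FiniteDimensional ℚ (vertexSpan V x) :=
  FiniteDimensional.span_finset ℚ _

lemma edgeSpan_le_vertexSpan {F : Finset β} {V : Finset α} (hF : ∀ e ∈ F, a e ∈ V ∧ b e ∈ V)
    (x : α) : edgeSpan a b (F : Set β) ≤ vertexSpan V x := by
  refine edgeSpan_le fun e he => ?_
  have := Submodule.sub_mem _ (mem_vertexSpan x (hF e he).2) (mem_vertexSpan x (hF e he).1)
  rwa [sub_sub_sub_cancel_left] at this

lemma finrank_edgeSpan_lt {F : Finset β} {V : Finset α} (hF : ∀ e ∈ F, a e ∈ V ∧ b e ∈ V)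
    (hV : V.Nonempty) : Module.finrank ℚ (edgeSpan a b (F : Set β)) < V.card := by
  obtain ⟨x, hx⟩ := hV
  exact (Submodule.finrank_mono (edgeSpan_le_vertexSpan hF x)).trans_lt (finrank_vertexSpan_lt hx)

/-- If the incidence vectors of `F` span a space of dimension `|V| - 1`, then `F` connects `V`. -/
lemma conn_of_card_le {F : Finset β} {V : Finset α} (hF : ∀ e ∈ F, a e ∈ V ∧ b e ∈ V)
    (h : V.card ≤ Module.finrank ℚ (edgeSpan a b (F : Set β)) + 1) :
    ∀ x ∈ V, ∀ y ∈ V, Conn a b F x y := by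
  intro x hx y hy
  have hD := finrank_vertexSpan_lt hx
  rw [conn_iff, Submodule.eq_of_le_of_finrank_le (edgeSpan_le_vertexSpan hF x) (by omega)]
  exact mem_vertexSpan x hy

/-- Replacing an element of a circuit by the element that closes it does not change the span. -/
lemma edgeSpan_exchange {B C : Set β} {e f : β} (hCB : C ⊆ B) (hf : f ∈ C)
    (he : edgeVec a b e ∈ edgeSpan a b C) (hef : edgeVec a b e ∉ edgeSpan a b (C \ {f})) :
    edgeSpan a b (insert e (B \ {f})) = edgeSpan a b B := by
  have hfm : edgeVec a b f ∈ edgeSpan a b (insert e (C \ {f})) := by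
    have h1 : edgeVec a b e ∈ Submodule.span ℚ
        (insert (edgeVec a b f) (edgeVec a b '' (C \ {f}))) := by
      rw [← Set.image_insert_eq, Set.insert_sdiff_singleton, Set.insert_eq_of_mem hf]
      exact he
    have h2 := mem_span_insert_exchange h1 hef
    rwa [← Set.image_insert_eq] at h2
  apply le_antisymm
  · refine edgeSpan_le ?_
    rintro g (rfl | hg)
    · exact edgeSpan_mono hCB he
    · exact edgeVec_mem hg.1
  · refine edgeSpan_le fun g hg => ?_
    by_cases hgf : g = f
    · subst hgf
      exact edgeSpan_mono (Set.insert_subset_insert (Set.sdiff_subset_sdiff_left hCB)) hfm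
    · exact edgeVec_mem (Or.inr ⟨hg, hgf⟩)

/-- `C` is minimal such that the incidence vector of `e` is in its span. -/
def IsMinSpanning (a b : β → α) (C : Finset β) (e : β) : Prop :=
  edgeVec a b e ∈ edgeSpan a b (C : Set β) ∧
    ∀ f ∈ C, edgeVec a b e ∉ edgeSpan a b ((C : Set β) \ {f})

lemma exists_isMinSpanning {F : Finset β} {e : β} (h : edgeVec a b e ∈ edgeSpan a b (F : Set β)) :
    ∃ C ⊆ F, IsMinSpanning a b C e := by
  induction F using Finset.strongInduction with
  | H F ih =>
    by_cases hF : ∀ f ∈ F, edgeVec a b e ∉ edgeSpan a b ((F : Set β) \ {f})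
    · exact ⟨F, subset_rfl, h, hF⟩
    · push Not at hF
      obtain ⟨f, hf, hf'⟩ := hF
      rw [← Finset.coe_erase] at hf'
      obtain ⟨C, hC, hC'⟩ := ih _ (Finset.erase_ssubset hf) hf'
      exact ⟨C, hC.trans (Finset.erase_subset _ _), hC'⟩

lemma exists_redundant {F : Finset β}
    (h : Module.finrank ℚ (edgeSpan a b (F : Set β)) < F.card) :
    ∃ e ∈ F, edgeVec a b e ∈ edgeSpan a b ((F : Set β) \ {e}) := by
  by_contra! hc
  have hli : LinearIndepOn ℚ (edgeVec a b) (F : Set β) := linearIndepOn_iff_notMem_span.2 hc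
  have h1 : edgeSpan a b (F : Set β) = Submodule.span ℚ (Set.range fun e : F => edgeVec a b e) := by
    rw [edgeSpan, Set.image_eq_range]; rfl
  have h2 := finrank_span_eq_card hli
  rw [h1] at h
  simp only [Finset.coe_sort_coe, Fintype.card_coe] at h2
  exact h.ne h2

end EdgeEnds

end

/-! ### Nash-Williams packing by augmentation. -/

section

open scoped Classical

namespace EdgeEnds

variable {α β : Type*} (a b : β → α)

/-- The edges of `I` with both ends in `X`. -/
noncomputable def inside (I : Finset β) (X : Finset α) : Finset β :=
  I.filter fun e => a e ∈ X ∧ b e ∈ X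

/-- Every nonempty vertex set `X` spans at most `m (|X| - 1)` edges of `I`. -/
def Sparse (m : ℕ) (I : Finset β) : Prop :=
  ∀ X : Finset α, X.Nonempty → (inside a b I X).card + m ≤ m * X.card

/-- A family of pairwise disjoint subsets of `I`. -/
def IsPacking {m : ℕ} (I : Finset β) (F : Fin m → Finset β) : Prop :=
  (∀ j, F j ⊆ I) ∧ ∀ i j, i ≠ j → Disjoint (F i) (F j)

/-- The total rank of a family of edge sets. -/
noncomputable def totalRank {m : ℕ} (F : Fin m → Finset β) : ℕ :=
  ∑ j, Module.finrank ℚ (edgeSpan a b (F j : Set β))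

/-- A packing together with an uncovered edge. -/
def IsState {m : ℕ} (I : Finset β) (s : (Fin m → Finset β) × β) : Prop :=
  IsPacking I s.1 ∧ s.2 ∈ I ∧ ∀ j, s.2 ∉ s.1 j

/-- The uncovered edge enters a class of the packing, and an edge of the circuit that it closes
there becomes uncovered. -/
def Step {m : ℕ} (s s' : (Fin m → Finset β) × β) : Prop :=
  ∃ j C f, C ⊆ s.1 j ∧ IsMinSpanning a b C s.2 ∧ f ∈ C ∧
    s' = (Function.update s.1 j (insert s.2 ((s.1 j).erase f)), f)

variable {a b}

lemma mem_inside {I : Finset β} {X : Finset α} {e : β} :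
    e ∈ inside a b I X ↔ e ∈ I ∧ a e ∈ X ∧ b e ∈ X := by
  simp [inside]

lemma IsPacking.update {m : ℕ} {I : Finset β} {F : Fin m → Finset β} (hF : IsPacking I F)
    {j : Fin m} {K : Finset β} (hK : K ⊆ I) (hd : ∀ i, i ≠ j → Disjoint (F i) K) :
    IsPacking I (Function.update F j K) := by
  refine ⟨fun i => ?_, fun i i' hii => ?_⟩
  · by_cases hi : i = j
    · subst hi; simpa using hK
    · simpa [hi] using hF.1 i
  · by_cases hi : i = j
    · subst hi
      simpa [hii.symm] using (hd i' hii.symm).symm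
    · by_cases hi' : i' = j
      · subst hi'
        simpa [hi] using hd i hi
      · simpa [hi, hi'] using hF.2 i i' hii

lemma Step.isState {m : ℕ} {I : Finset β} {s s' : (Fin m → Finset β) × β} (h : Step a b s s')
    (hs : IsState I s) : IsState I s' := by
  obtain ⟨j, C, f, hC, -, hf, rfl⟩ := h
  have hfj := hC hf
  refine ⟨hs.1.update ?_ ?_, hs.1.1 j hfj, fun i => ?_⟩
  · exact Finset.insert_subset hs.2.1 ((Finset.erase_subset _ _).trans (hs.1.1 j))
  · intro i hi
    exact Finset.disjoint_insert_right.2 ⟨hs.2.2 i,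
      (hs.1.2 i j hi).mono_right (Finset.erase_subset _ _)⟩
  · by_cases hi : i = j
    · subst hi
      have : f ≠ s.2 := fun h => hs.2.2 i (h ▸ hfj)
      simp [this]
    · simpa [hi] using Finset.disjoint_right.1 (hs.1.2 i j hi) hfj

/-- Every edge of `C` could be the one uncovered by the step, so `hA` puts all of `C` into `A`. The
exchange thus takes place within `A`. -/
lemma Step.edgeSpan_eq {m : ℕ} {s s' : (Fin m → Finset β) × β}
    (h : Step a b s s') {A : Set β} (hA : ∀ s'', Step a b s s'' → s''.2 ∈ A) (hsA : s.2 ∈ A)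
    (i : Fin m) :
    edgeSpan a b ((s'.1 i : Set β) ∩ A) = edgeSpan a b ((s.1 i : Set β) ∩ A) := by
  obtain ⟨j, C, f, hC, hmin, hf, rfl⟩ := h
  have hCA : (C : Set β) ⊆ A := fun g hg => hA _ ⟨j, C, g, hC, hmin, hg, rfl⟩
  by_cases hi : i = j
  · subst hi
    have h1 := edgeSpan_exchange (B := (s.1 i : Set β) ∩ A) (C := C) (e := s.2) (f := f)
      (Set.subset_inter (by exact_mod_cast hC) hCA) hf hmin.1 (hmin.2 f hf)
    rw [← h1]
    congr 1
    ext g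
    simp only [Function.update_self, Finset.coe_insert, Finset.coe_erase, Set.mem_inter_iff,
      Set.mem_insert_iff, Set.mem_sdiff, Set.mem_singleton_iff]
    constructor
    · rintro ⟨rfl | h, h'⟩
      · exact Or.inl rfl
      · exact Or.inr ⟨⟨h.1, h'⟩, h.2⟩
    · rintro (rfl | h)
      · exact ⟨Or.inl rfl, hsA⟩
      · exact ⟨Or.inr ⟨h.1.1, h.2⟩, h.1.2⟩
  · simp [hi]

lemma Step.totalRank_eq {m : ℕ} {s s' : (Fin m → Finset β) × β} (h : Step a b s s') :
    totalRank a b s'.1 = totalRank a b s.1 := by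
  refine Finset.sum_congr rfl fun i _ => ?_
  have := h.edgeSpan_eq (A := Set.univ) (fun _ _ => Set.mem_univ _) (Set.mem_univ _) i
  simp only [Set.inter_univ] at this
  rw [this]

/-- Otherwise the uncovered edge could be added to class `j`, which would raise the total rank. -/
lemma IsState.mem_edgeSpan {m : ℕ} {I : Finset β} {s : (Fin m → Finset β) × β}
    (hs : IsState I s)
    (hmax : ∀ F : Fin m → Finset β, IsPacking I F → totalRank a b F ≤ totalRank a b s.1)
    (j : Fin m) : edgeVec a b s.2 ∈ edgeSpan a b (s.1 j : Set β) := by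
  by_contra hn
  have hp : IsPacking I (Function.update s.1 j (insert s.2 (s.1 j))) :=
    hs.1.update (Finset.insert_subset hs.2.1 (hs.1.1 j)) fun i hi =>
      Finset.disjoint_insert_right.2 ⟨hs.2.2 i, hs.1.2 i j hi⟩
  refine (hmax _ hp).not_gt ?_
  refine Finset.sum_lt_sum (fun i _ => ?_) ⟨j, Finset.mem_univ _, ?_⟩
  · by_cases hi : i = j
    · subst hi
      rw [Function.update_self]
      exact Submodule.finrank_mono (edgeSpan_mono (by simp))
    · rw [Function.update_of_ne hi]
  · rw [Function.update_self]
    refine Submodule.finrank_lt_finrank_of_lt (lt_of_le_of_ne (edgeSpan_mono (by simp)) ?_)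
    intro heq
    rw [heq] at hn
    exact hn (edgeVec_mem (by simp))

/-- A walk that starts in a set closed under adjacency stays in that set. -/
lemma Conn.restrict {F : Set β} {U : Set α} (hU : ∀ e ∈ F, a e ∈ U ↔ b e ∈ U) {x y : α}
    (h : Conn a b F x y) (hx : x ∈ U) : Conn a b {e ∈ F | a e ∈ U ∧ b e ∈ U} x y := by
  have hr : Equivalence fun x y : α => (x ∈ U ↔ y ∈ U) ∧
      (x ∈ U → Conn a b {e ∈ F | a e ∈ U ∧ b e ∈ U} x y) :=
    { refl := fun x => ⟨Iff.rfl, fun _ => Conn.refl _ _⟩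
      symm := fun h => ⟨h.1.symm, fun hy => (h.2 (h.1.2 hy)).symm⟩
      trans := fun h h' => ⟨h.1.trans h'.1, fun hx => (h.2 hx).trans (h'.2 (h.1.1 hx))⟩ }
  exact (Conn.lift hr (fun e he => ⟨hU e he, fun ha =>
    Conn.edge ⟨he, ha, (hU e he).1 ha⟩⟩) h).2 hx

/-- Let `A` be the set of edges that can become uncovered by a chain of steps. Each class spans `A`
using only its own edges in `A`. So in the component `U` of `A` at the uncovered edge, every class
has at least |U| - 1 edges, and the uncovered edge is one too many. -/
lemma not_sparse_of_isState {m : ℕ} {I : Finset β} {V : Finset α}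
    (hV : ∀ e ∈ I, a e ∈ V ∧ b e ∈ V) {s : (Fin m → Finset β) × β} (hs : IsState I s)
    (hmax : ∀ F : Fin m → Finset β, IsPacking I F → totalRank a b F ≤ totalRank a b s.1) :
    ¬ Sparse a b m I := by
  intro hsp
  let A : Set β := {e | ∃ F, Relation.ReflTransGen (Step a b) s (F, e)}
  have hstate : ∀ s', Relation.ReflTransGen (Step a b) s s' →
      IsState I s' ∧ totalRank a b s'.1 = totalRank a b s.1 ∧
      ∀ i, edgeSpan a b ((s'.1 i : Set β) ∩ A) = edgeSpan a b ((s.1 i : Set β) ∩ A) := by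
    intro s' h
    induction h with
    | refl => exact ⟨hs, rfl, fun _ => rfl⟩
    | tail h1 h2 ih =>
      refine ⟨h2.isState ih.1, h2.totalRank_eq.trans ih.2.1, fun i => ?_⟩
      rw [← ih.2.2 i]
      exact h2.edgeSpan_eq (A := A) (fun s'' h3 => ⟨s''.1, h1.tail h3⟩) ⟨_, h1⟩ i
  have hAI : A ⊆ I := fun e ⟨F, hF⟩ => (hstate _ hF).1.2.1
  have hA : ∀ e ∈ A, ∀ i, edgeVec a b e ∈ edgeSpan a b ((s.1 i : Set β) ∩ A) := by
    rintro e ⟨F, hF⟩ i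
    obtain ⟨h1, h2, h3⟩ := hstate _ hF
    obtain ⟨C, hC, hmin⟩ := exists_isMinSpanning
      (h1.mem_edgeSpan (fun F' hF' => (hmax F' hF').trans h2.ge) i)
    rw [← h3]
    refine edgeSpan_mono ?_ hmin.1
    exact fun f hf => ⟨hC hf, _, hF.tail ⟨i, C, f, hC, hmin, hf, rfl⟩⟩
  have hs2 : s.2 ∈ A := ⟨s.1, Relation.ReflTransGen.refl⟩
  let U : Finset α := V.filter fun x => Conn a b A (a s.2) x
  have hUV : ∀ e ∈ A, a e ∈ U ↔ b e ∈ U := by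
    intro e he
    have := hV e (hAI he)
    simp only [U, Finset.mem_filter, this, true_and]
    exact ⟨fun h => h.trans (Conn.edge he), fun h => h.trans (Conn.edge he).symm⟩
  have haU : a s.2 ∈ U := Finset.mem_filter.2 ⟨(hV _ hs.2.1).1, Conn.refl _ _⟩
  have hcard : ∀ i, U.card ≤ (inside a b (s.1 i) U).card + 1 := by
    intro i
    refine card_le_card_add_one_of_conn (a := a) (b := b) fun x hx y hy => ?_
    have h1 : Conn a b A x y := (Finset.mem_filter.1 hx).2.symm.trans (Finset.mem_filter.1 hy).2
    have h2 : Conn a b ((s.1 i : Set β) ∩ A) x y :=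
      conn_iff.2 ((edgeSpan_le fun e he => hA e he i) (conn_iff.1 h1))
    refine (h2.restrict (U := U) (fun e he => hUV e he.2) hx).mono ?_
    rintro e ⟨he, h3⟩
    exact mem_inside.2 ⟨he.1, h3⟩
  have hdisj : (inside a b I U).card ≥ ∑ i, (inside a b (s.1 i) U).card + 1 := by
    have h1 : Set.PairwiseDisjoint (↑(Finset.univ : Finset (Fin m)))
        (fun i => inside a b (s.1 i) U) := fun i _ j _ hij =>
      (hs.1.2 i j hij).mono (Finset.filter_subset _ _) (Finset.filter_subset _ _)
    have h2 : s.2 ∉ Finset.univ.biUnion fun i => inside a b (s.1 i) U := by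
      simp only [Finset.mem_biUnion, Finset.mem_univ, true_and, not_exists]
      exact fun i hi => hs.2.2 i (mem_inside.1 hi).1
    rw [← Finset.card_biUnion h1, ← Finset.card_insert_of_notMem h2]
    refine Finset.card_le_card (Finset.insert_subset
      (mem_inside.2 ⟨hs.2.1, haU, (hUV _ hs2).1 haU⟩) ?_)
    intro e he
    simp only [Finset.mem_biUnion, Finset.mem_univ, true_and] at he
    obtain ⟨i, hi⟩ := he
    rw [mem_inside] at hi ⊢
    exact ⟨hs.1.1 i hi.1, hi.2⟩
  have h1 := hsp U ⟨_, haU⟩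
  have h2 : m * U.card ≤ ∑ i, (inside a b (s.1 i) U).card + m := by
    calc m * U.card = ∑ _i : Fin m, U.card := by simp
      _ ≤ ∑ i : Fin m, ((inside a b (s.1 i) U).card + 1) := Finset.sum_le_sum fun i _ => hcard i
      _ = _ := by simp [Finset.sum_add_distrib]
  omega

/-- Nash-Williams: a sparse edge set with `m (|V| - 1)` edges contains `m` disjoint sets that
connect `V`. -/
theorem Sparse.exists_packing {m : ℕ} {I : Finset β} {V : Finset α}
    (hsp : Sparse a b m I) (hV : ∀ e ∈ I, a e ∈ V ∧ b e ∈ V) (hcard : m * V.card ≤ I.card + m) :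
    ∃ F : Fin m → Finset β, IsPacking I F ∧
      ∀ j, ∀ x ∈ V, ∀ y ∈ V, Conn a b (F j : Set β) x y := by
  obtain ⟨F, hF, hmax⟩ : ∃ F : Fin m → Finset β, IsPacking I F ∧
      ∀ F' : Fin m → Finset β, IsPacking I F' → totalRank a b F' ≤ totalRank a b F := by
    let S : Finset (Fin m → Finset β) :=
      (Fintype.piFinset fun _ => I.powerset).filter fun F => IsPacking I F
    have hS : ∀ F : Fin m → Finset β, F ∈ S ↔ IsPacking I F := by
      intro F
      simp only [S, Finset.mem_filter, Fintype.mem_piFinset, Finset.mem_powerset,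
        and_iff_right_iff_imp]
      exact fun h => h.1
    obtain ⟨F, hF, hmax⟩ := S.exists_max_image (totalRank a b)
      ⟨fun _ => ∅, (hS _).2 ⟨fun _ => Finset.empty_subset _, fun _ _ _ => by simp⟩⟩
    exact ⟨F, (hS F).1 hF, fun F' hF' => hmax F' ((hS F').2 hF')⟩
  by_cases hall : ∀ j, V.card ≤ Module.finrank ℚ (edgeSpan a b (F j : Set β)) + 1
  · exact ⟨F, hF, fun j => conn_of_card_le (fun e he => hV e (hF.1 j he)) (hall j)⟩
  exfalso
  push Not at hall
  obtain ⟨j0, hj0⟩ := hall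
  have hrank : ∀ j, Module.finrank ℚ (edgeSpan a b (F j : Set β)) + 1 ≤ V.card := by
    intro j
    exact finrank_edgeSpan_lt (fun e he => hV e (hF.1 j he)) (Finset.card_pos.1 (by omega))
  have hlt : totalRank a b F + m < m * V.card := by
    calc totalRank a b F + m
        = ∑ j, (Module.finrank ℚ (edgeSpan a b (F j : Set β)) + 1) := by
          simp [totalRank, Finset.sum_add_distrib]
      _ < ∑ _j : Fin m, V.card :=
          Finset.sum_lt_sum (fun j _ => hrank j) ⟨j0, Finset.mem_univ _, hj0⟩
      _ = _ := by simp
  by_cases hcov : ∃ e ∈ I, ∀ j, e ∉ F j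
  · obtain ⟨e, he, he'⟩ := hcov
    exact not_sparse_of_isState hV (s := (F, e)) ⟨hF, he, he'⟩ hmax hsp
  -- All edges are covered, but the total rank is below |I|. So some class has a redundant edge, and
  -- dropping it gives an uncovered edge at the same total rank.
  · push Not at hcov
    have h1 : I.card ≤ ∑ j, (F j).card := by
      refine (Finset.card_le_card fun e he => ?_).trans Finset.card_biUnion_le
      obtain ⟨j, hj⟩ := hcov e he
      exact Finset.mem_biUnion.2 ⟨j, Finset.mem_univ _, hj⟩
    obtain ⟨j, -, hj⟩ := Finset.exists_lt_of_sum_lt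
      (show totalRank a b F < ∑ j, (F j).card by omega)
    obtain ⟨e, he, hred⟩ := exists_redundant hj
    have hp : IsPacking I (Function.update F j ((F j).erase e)) :=
      hF.update ((Finset.erase_subset _ _).trans (hF.1 j)) fun i hi =>
        (hF.2 i j hi).mono_right (Finset.erase_subset _ _)
    have hr : totalRank a b (Function.update F j ((F j).erase e)) = totalRank a b F := by
      refine Finset.sum_congr rfl fun i _ => ?_
      by_cases hi : i = j
      · subst hi
        suffices this : edgeSpan a b ((F i : Set β) \ {e}) = edgeSpan a b (F i : Set β) by
          rw [Function.update_self, Finset.coe_erase, this]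
        refine le_antisymm (edgeSpan_mono Set.sdiff_subset) (edgeSpan_le fun f hf => ?_)
        by_cases hfe : f = e
        · exact hfe ▸ hred
        · exact edgeVec_mem ⟨hf, hfe⟩
      · rw [Function.update_of_ne hi]
    refine not_sparse_of_isState hV (s := (Function.update F j ((F j).erase e), e))
      ⟨hp, hF.1 j he, fun i => ?_⟩ (fun F' hF' => (hmax F' hF').trans hr.ge) hsp
    by_cases hi : i = j
    · subst hi; simp
    · simpa [hi] using Finset.disjoint_right.1 (hF.2 i j hi) he

end EdgeEnds

end

/-! ### Tight sets and the partition into maximal tight sets. -/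

section

open scoped Classical

namespace EdgeEnds

variable {α β : Type*} (a b : β → α)

/-- The nonempty vertex set `X` spans exactly `m (|X| - 1)` edges of `I`. -/
def Tight (m : ℕ) (I : Finset β) (X : Finset α) : Prop :=
  X.Nonempty ∧ (inside a b I X).card + m = m * X.card

/-- The largest tight subset of `V` that contains `x`. -/
noncomputable def part (m : ℕ) (I : Finset β) (V : Finset α) (x : α) : Finset α :=
  (V.powerset.filter fun X => Tight a b m I X ∧ x ∈ X).sup id

/-- The maximal tight subsets of `V`. -/
noncomputable def parts (m : ℕ) (I : Finset β) (V : Finset α) : Finset (Finset α) :=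
  V.image (part a b m I V)

variable {a b} {m : ℕ} {I E : Finset β} {V X Y : Finset α}

lemma inside_subset : inside a b I X ⊆ I := Finset.filter_subset _ _

lemma inside_mono (h : X ⊆ Y) : inside a b I X ⊆ inside a b I Y := fun e he => by
  rw [mem_inside] at he ⊢
  exact ⟨he.1, h he.2.1, h he.2.2⟩

lemma inside_inter : inside a b I (X ∩ Y) = inside a b I X ∩ inside a b I Y := by
  ext e
  simp only [mem_inside, Finset.mem_inter]
  tauto

lemma card_inside_add_le :
    (inside a b I X).card + (inside a b I Y).card ≤
      (inside a b I (X ∪ Y)).card + (inside a b I (X ∩ Y)).card := by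
  rw [← Finset.card_union_add_card_inter, inside_inter]
  gcongr
  exact Finset.union_subset (inside_mono Finset.subset_union_left)
    (inside_mono Finset.subset_union_right)

/-- The number of edges inside a set is supermodular and m(|X| - 1) is modular, so the sparsity
bounds of union and intersection must both be attained. -/
lemma Sparse.tight_union_inter (hI : Sparse a b m I) (hX : Tight a b m I X) (hY : Tight a b m I Y)
    (h : (X ∩ Y).Nonempty) : Tight a b m I (X ∪ Y) ∧ Tight a b m I (X ∩ Y) := by
  have hu : (X ∪ Y).Nonempty := hX.1.mono Finset.subset_union_left
  have h1 := hI _ h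
  have h2 := hI _ hu
  have h3 := card_inside_add_le (a := a) (b := b) (I := I) (X := X) (Y := Y)
  have h4 := hX.2
  have h5 := hY.2
  have h6 : m * (X ∪ Y).card + m * (X ∩ Y).card = m * X.card + m * Y.card := by
    rw [← mul_add, ← mul_add, Finset.card_union_add_card_inter]
  exact ⟨⟨hu, by omega⟩, ⟨h, by omega⟩⟩

lemma Sparse.tight_union (hI : Sparse a b m I) (hX : Tight a b m I X) (hY : Tight a b m I Y)
    (h : (X ∩ Y).Nonempty) : Tight a b m I (X ∪ Y) :=
  (hI.tight_union_inter hX hY h).1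

lemma Sparse.tight_singleton (hI : Sparse a b m I) (x : α) : Tight a b m I {x} := by
  have := hI {x} (Finset.singleton_nonempty x)
  refine ⟨Finset.singleton_nonempty x, ?_⟩
  simp only [Finset.card_singleton, mul_one] at this ⊢
  omega

lemma Sparse.mono {J : Finset β} (hI : Sparse a b m I) (h : J ⊆ I) : Sparse a b m J :=
  fun X hX => le_trans (by gcongr; exact Finset.filter_subset_filter _ h) (hI X hX)

/-- Tight sets that contain `x` meet, so their union is tight. The alternative `∅` in the induction
serves only the bottom element of `sup`; it is excluded because `{x}` is tight. -/
lemma Sparse.part_spec (hI : Sparse a b m I) {x : α} (hx : x ∈ V) :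
    Tight a b m I (part a b m I V x) ∧ x ∈ part a b m I V x ∧ part a b m I V x ⊆ V := by
  have hx' : x ∈ part a b m I V x := Finset.mem_sup.2
    ⟨{x}, by simp [hx, hI.tight_singleton x], Finset.mem_singleton_self x⟩
  have h : part a b m I V x = ∅ ∨
      (Tight a b m I (part a b m I V x) ∧ x ∈ part a b m I V x ∧ part a b m I V x ⊆ V) := by
    refine Finset.sup_induction (p := fun T => T = ∅ ∨ (Tight a b m I T ∧ x ∈ T ∧ T ⊆ V))
      (Or.inl rfl) ?_ ?_
    · rintro X (rfl | hX) Y (rfl | hY)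
      · simp
      · simpa using Or.inr hY
      · simpa using Or.inr hX
      · exact Or.inr ⟨hI.tight_union hX.1 hY.1 ⟨x, Finset.mem_inter.2 ⟨hX.2.1, hY.2.1⟩⟩,
          Finset.mem_union_left _ hX.2.1, Finset.union_subset hX.2.2 hY.2.2⟩
    · intro X hX
      simp only [Finset.mem_filter, Finset.mem_powerset] at hX
      exact Or.inr ⟨hX.2.1, hX.2.2, hX.1⟩
  rcases h with h | h
  · simp [h] at hx'
  · exact h

lemma Tight.subset_part (hX : Tight a b m I X) (hXV : X ⊆ V) {x : α} (hx : x ∈ X) :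
    X ⊆ part a b m I V x :=
  Finset.le_sup (f := id) (b := X)
    (Finset.mem_filter.2 ⟨Finset.mem_powerset.2 hXV, hX, hx⟩)

lemma Sparse.part_eq (hI : Sparse a b m I) {x y : α} (hx : x ∈ V)
    (hy : y ∈ part a b m I V x) : part a b m I V y = part a b m I V x := by
  obtain ⟨h1, h2, h3⟩ := hI.part_spec hx
  obtain ⟨h4, h5, h6⟩ := hI.part_spec (h3 hy)
  have h7 := h1.subset_part h3 hy
  exact (h4.subset_part h6 (h7 h2)).antisymm h7

lemma mem_parts : X ∈ parts a b m I V ↔ ∃ x ∈ V, part a b m I V x = X := by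
  simp [parts]

lemma Sparse.part_eq_of_mem_parts (hI : Sparse a b m I) (hX : X ∈ parts a b m I V) {x : α}
    (hx : x ∈ X) : part a b m I V x = X := by
  obtain ⟨y, hy, rfl⟩ := mem_parts.1 hX
  exact hI.part_eq hy hx

lemma Sparse.parts_spec (hI : Sparse a b m I) (hX : X ∈ parts a b m I V) :
    Tight a b m I X ∧ X ⊆ V := by
  obtain ⟨y, hy, rfl⟩ := mem_parts.1 hX
  exact ⟨(hI.part_spec hy).1, (hI.part_spec hy).2.2⟩

lemma Sparse.parts_disjoint (hI : Sparse a b m I) (hX : X ∈ parts a b m I V)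
    (hY : Y ∈ parts a b m I V) (h : X ≠ Y) : Disjoint X Y :=
  Finset.disjoint_left.2 fun _ hx hy =>
    h ((hI.part_eq_of_mem_parts hX hx).symm.trans (hI.part_eq_of_mem_parts hY hy))

/-- The number of edges spanned by a union of maximal tight sets. -/
lemma Sparse.card_inside_biUnion (hI : Sparse a b m I) {P : Finset (Finset α)}
    (hP : P ⊆ parts a b m I V) :
    (inside a b I (P.biUnion id)).card + m * P.card = m * (P.biUnion id).card +
      ((inside a b I (P.biUnion id)).filter
        fun e => part a b m I V (a e) ≠ part a b m I V (b e)).card := by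
  have hd : (P : Set (Finset α)).PairwiseDisjoint id := fun X hX Y hY h =>
    hI.parts_disjoint (hP hX) (hP hY) h
  have h1 : ((inside a b I (P.biUnion id)).filter
        fun e => part a b m I V (a e) = part a b m I V (b e)) =
      P.biUnion fun X => inside a b I X := by
    ext e
    simp only [Finset.mem_filter, mem_inside, Finset.mem_biUnion, id]
    constructor
    · rintro ⟨⟨he, ⟨X, hX, hXa⟩, ⟨Y, hY, hYb⟩⟩, h⟩
      rw [hI.part_eq_of_mem_parts (hP hX) hXa, hI.part_eq_of_mem_parts (hP hY) hYb] at h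
      subst h
      exact ⟨X, hX, he, hXa, hYb⟩
    · rintro ⟨X, hX, he, h1, h2⟩
      exact ⟨⟨he, ⟨X, hX, h1⟩, ⟨X, hX, h2⟩⟩, by
        rw [hI.part_eq_of_mem_parts (hP hX) h1, hI.part_eq_of_mem_parts (hP hX) h2]⟩
  have hd' : (P : Set (Finset α)).PairwiseDisjoint fun X => inside a b I X := by
    intro X hX Y hY h
    refine Finset.disjoint_left.2 fun e he he' => ?_
    exact Finset.disjoint_left.1 (hd hX hY h) (mem_inside.1 he).2.1 (mem_inside.1 he').2.1
  have h2 : (P.biUnion fun X => inside a b I X).card + m * P.card = m * (P.biUnion id).card := by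
    rw [Finset.card_biUnion hd', Finset.card_biUnion hd, Finset.mul_sum, mul_comm m,
      ← smul_eq_mul, ← Finset.sum_const, ← Finset.sum_add_distrib]
    exact Finset.sum_congr rfl fun X hX => (hI.parts_spec (hP hX)).1.2
  have h3 := Finset.card_filter_add_card_filter_not (s := inside a b I (P.biUnion id))
    (fun e => part a b m I V (a e) = part a b m I V (b e))
  rw [h1] at h3
  simp only [ne_eq]
  omega

lemma Sparse.biUnion_parts (hI : Sparse a b m I) : (parts a b m I V).biUnion id = V := by
  ext x
  simp only [Finset.mem_biUnion, id]
  exact ⟨fun ⟨X, hX, hx⟩ => (hI.parts_spec hX).2 hx,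
    fun hx => ⟨_, mem_parts.2 ⟨x, hx, rfl⟩, (hI.part_spec hx).2.1⟩⟩

lemma Conn.contract {ι : Type*} [DecidableEq ι] {F : Finset β} (p : α → ι) {x y : α}
    (h : Conn a b (F : Set β) x y) :
    Conn (p ∘ a) (p ∘ b) ((F.filter fun e => p (a e) ≠ p (b e) : Finset β) : Set β) (p x) (p y) := by
  refine Conn.lift (r := fun x y => Conn (p ∘ a) (p ∘ b)
    ((F.filter fun e => p (a e) ≠ p (b e) : Finset β) : Set β) (p x) (p y))
    ⟨fun _ => Conn.refl _ _, fun h => h.symm, fun h h' => h.trans h'⟩ ?_ h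
  intro e he
  by_cases hp : p (a e) = p (b e)
  · rw [hp]; exact Conn.refl _ _
  · exact Conn.edge (a := p ∘ a) (b := p ∘ b) (by simpa using ⟨he, hp⟩)

/-- If `m` disjoint edge sets connect `Y`, then every partition of `Y` into `k` classes is crossed
by at least `m (k - 1)` edges. -/
lemma IsPacking.card_crossing {ι : Type*} [DecidableEq ι] {F : Fin m → Finset β} (hF : IsPacking I F)
    (hc : ∀ j, ∀ x ∈ Y, ∀ y ∈ Y, Conn a b (F j : Set β) x y) (p : α → ι) :
    m * (Y.image p).card ≤ (I.filter fun e => p (a e) ≠ p (b e)).card + m := by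
  have h1 : ∀ j, (Y.image p).card ≤ ((F j).filter fun e => p (a e) ≠ p (b e)).card + 1 := by
    intro j
    refine card_le_card_add_one_of_conn (a := p ∘ a) (b := p ∘ b) ?_
    intro u hu v hv
    obtain ⟨x, hx, rfl⟩ := Finset.mem_image.1 hu
    obtain ⟨y, hy, rfl⟩ := Finset.mem_image.1 hv
    exact (hc j x hx y hy).contract p
  have h2 : ∑ j, ((F j).filter fun e => p (a e) ≠ p (b e)).card ≤
      (I.filter fun e => p (a e) ≠ p (b e)).card := by
    rw [← Finset.card_biUnion fun i _ j _ hij => (hF.2 i j hij).mono (Finset.filter_subset _ _)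
      (Finset.filter_subset _ _)]
    refine Finset.card_le_card (Finset.biUnion_subset.2 fun j _ => ?_)
    exact Finset.filter_subset_filter _ (hF.1 j)
  calc m * (Y.image p).card = ∑ _j : Fin m, (Y.image p).card := by simp
    _ ≤ ∑ j : Fin m, (((F j).filter fun e => p (a e) ≠ p (b e)).card + 1) :=
        Finset.sum_le_sum fun j _ => h1 j
    _ ≤ _ := by simpa [Finset.sum_add_distrib] using h2

/-- A set that is connected by `m` disjoint edge sets lies in a maximal tight set. -/
lemma Sparse.subset_part_of_packing (hI : Sparse a b m I)
    (hE : ∀ e ∈ E, e ∉ I → ∃ X ⊆ V, Tight a b m I X ∧ a e ∈ X ∧ b e ∈ X)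
    (hYV : Y ⊆ V) {F : Fin m → Finset β} (hF : IsPacking (inside a b E Y) F)
    (hc : ∀ j, ∀ x ∈ Y, ∀ y ∈ Y, Conn a b (F j : Set β) x y) {x : α} (hx : x ∈ Y) :
    Y ⊆ part a b m I V x := by
  let P := Y.image (part a b m I V)
  have hP : P ⊆ parts a b m I V := Finset.image_subset_image hYV
  have hYZ : Y ⊆ P.biUnion id := fun y hy => Finset.mem_biUnion.2
    ⟨_, Finset.mem_image_of_mem _ hy, (hI.part_spec (hYV hy)).2.1⟩
  have hZV : P.biUnion id ⊆ V := Finset.biUnion_subset.2 fun X hX => (hI.parts_spec (hP hX)).2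
  have h1 := hF.card_crossing hc (part a b m I V)
  have h2 : ((inside a b E Y).filter
      fun e => part a b m I V (a e) ≠ part a b m I V (b e)) ⊆
      ((inside a b I (P.biUnion id)).filter
        fun e => part a b m I V (a e) ≠ part a b m I V (b e)) := by
    intro e he
    rw [Finset.mem_filter, mem_inside] at he ⊢
    refine ⟨⟨?_, hYZ he.1.2.1, hYZ he.1.2.2⟩, he.2⟩
    by_contra hn
    obtain ⟨X, hXV, hX, h3, h4⟩ := hE e he.1.1 hn
    exact he.2 (hI.part_eq (hXV h4) (hX.subset_part hXV h4 h3))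
  have h3 := Finset.card_le_card h2
  have h4 := hI.card_inside_biUnion hP
  have hne : (P.biUnion id).Nonempty := ⟨x, hYZ hx⟩
  have h5 := hI _ hne
  change m * P.card ≤ _ at h1
  -- The packing forces at least m(|P| - 1) edges between the parts that meet `Y`, all of them in
  -- `I`. With the edges inside these tight parts, their union has m(|Z| - 1) edges, where Z is the
  -- union, and hence is tight.
  have ht : Tight a b m I (P.biUnion id) := ⟨hne, by omega⟩
  exact hYZ.trans (ht.subset_part hZV (hYZ hx))

/-- A tight set is connected by `m` disjoint edge sets. -/
lemma Sparse.exists_packing_of_tight (hI : Sparse a b m I) (hX : Tight a b m I X) :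
    ∃ F : Fin m → Finset β, IsPacking (inside a b I X) F ∧
      ∀ j, ∀ x ∈ X, ∀ y ∈ X, Conn a b (F j : Set β) x y :=
  (hI.mono inside_subset).exists_packing (fun _ he => (mem_inside.1 he).2) hX.2.ge

end EdgeEnds

end

/-! ### Sparse bases of a graph and the formula for `Omega`. -/

section

open scoped Classical

namespace EdgeEnds

variable {α β : Type*} {a b : β → α} {m : ℕ} {I E : Finset β} {V X Y : Finset α}

/-- Dropping vertices outside `V` loses no edge of `I`, so sparsity of the smaller set leaves only
equality. -/
lemma Tight.inter_of_ends (hI : Sparse a b m I) (hV : ∀ e ∈ I, a e ∈ V ∧ b e ∈ V)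
    (hX : Tight a b m I X) (hXV : (X ∩ V).Nonempty) : Tight a b m I (X ∩ V) := by
  have h1 : inside a b I X ⊆ inside a b I (X ∩ V) := fun e he => by
    rw [mem_inside] at he ⊢
    simp [he.1, he.2.1, he.2.2, hV e he.1]
  have h2 := Finset.card_le_card h1
  have h3 := hI _ hXV
  have h4 := hX.2
  have h5 : m * (X ∩ V).card ≤ m * X.card := by gcongr; exact Finset.inter_subset_left
  exact ⟨hXV, by omega⟩

/-- A maximal sparse subset of `E`: the ends of each remaining edge are in a common tight set. -/
lemma exists_maximal_sparse (m : ℕ) (hE : ∀ e ∈ E, a e ∈ V ∧ b e ∈ V) :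
    ∃ I ⊆ E, Sparse a b m I ∧
      ∀ e ∈ E, e ∉ I → ∃ X ⊆ V, Tight a b m I X ∧ a e ∈ X ∧ b e ∈ X := by
  obtain ⟨I, hI, hmax⟩ := (E.powerset.filter fun I => Sparse a b m I).exists_max_image Finset.card
    ⟨∅, by
      simp only [Finset.mem_filter, Finset.empty_mem_powerset, true_and]
      intro X hX
      have : 1 ≤ X.card := hX.card_pos
      simp only [inside, Finset.filter_empty, Finset.card_empty, zero_add]
      nlinarith⟩
  rw [Finset.mem_filter, Finset.mem_powerset] at hI
  refine ⟨I, hI.1, hI.2, fun e he heI => ?_⟩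
  have hns : ¬ Sparse a b m (insert e I) := fun hs => by
    have := hmax (insert e I) (Finset.mem_filter.2
      ⟨Finset.mem_powerset.2 (Finset.insert_subset he hI.1), hs⟩)
    rw [Finset.card_insert_of_notMem heI] at this
    omega
  simp only [Sparse, not_forall, not_le] at hns
  obtain ⟨X, hX, hlt⟩ := hns
  have h1 := hI.2 X hX
  have hab : a e ∈ X ∧ b e ∈ X := by
    by_contra hn
    have : inside a b (insert e I) X = inside a b I X := by
      rw [inside, Finset.filter_insert, if_neg hn, inside]
    rw [this] at hlt
    omega
  have h2 : (inside a b (insert e I) X).card ≤ (inside a b I X).card + 1 := by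
    rw [inside, Finset.filter_insert, if_pos hab]
    exact Finset.card_insert_le _ _
  have hX' : Tight a b m I X := ⟨hX, by omega⟩
  refine ⟨X ∩ V, Finset.inter_subset_right,
    hX'.inter_of_ends hI.2 (fun e he => hE e (hI.1 he)) ⟨a e, ?_⟩, ?_, ?_⟩
  all_goals simp [hab, hE e he]

end EdgeEnds

namespace Graph

open EdgeEnds

variable {α β : Type*} {G K : Graph α β} {a b : β → α} {m : ℕ}

/-- `a e` and `b e` are the ends of each edge `e` of `G`. -/
def HasEnds (G : Graph α β) (a b : β → α) : Prop :=
  ∀ e ∈ E(G), G.IsLink e (a e) (b e)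

lemma exists_hasEnds (hV : V(G).Nonempty) : ∃ a b : β → α, G.HasEnds a b := by
  obtain ⟨v, -⟩ := hV
  have h : ∀ e, ∃ p : α × α, e ∈ E(G) → G.IsLink e p.1 p.2 := by
    intro e
    by_cases he : e ∈ E(G)
    · obtain ⟨x, y, h⟩ := exists_isLink_of_mem_edgeSet he
      exact ⟨(x, y), fun _ => h⟩
    · exact ⟨(v, v), fun h => absurd h he⟩
  choose p hp using h
  exact ⟨fun e => (p e).1, fun e => (p e).2, hp⟩

lemma HasEnds.of_le (h : G.HasEnds a b) (hK : K ≤ G) : K.HasEnds a b := fun e he =>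
  (hK.isLink_iff he).2 (h e (hK.edgeSet_mono he))

lemma Reachable.symm {x y : α} (h : G.Reachable x y) : G.Reachable y x := by
  induction h with
  | refl => exact Relation.ReflTransGen.refl
  | tail _ h2 ih => exact Relation.ReflTransGen.head h2.symm ih

lemma HasEnds.reachable_iff (h : G.HasEnds a b) {x y : α} :
    G.Reachable x y ↔ Conn a b E(G) x y := by
  constructor
  · intro hr
    induction hr with
    | refl => exact Conn.refl _ _
    | tail _ h2 ih =>
      obtain ⟨e, he⟩ := h2
      have := Conn.edge (a := a) (b := b) he.edge_mem
      rcases (h e he.edge_mem).eq_and_eq_or_eq_and_eq he with ⟨h1, h2⟩ | ⟨h1, h2⟩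
      · rw [h1, h2] at this; exact ih.trans this
      · rw [h1, h2] at this; exact ih.trans this.symm
  · exact Conn.lift (r := G.Reachable) ⟨fun _ => Relation.ReflTransGen.refl, fun h => h.symm,
      fun h1 h2 => Relation.ReflTransGen.trans h1 h2⟩
      fun e he => Relation.ReflTransGen.single ⟨e, h e he⟩

/-- A walk between the ends of `e` that avoids `e` could replace `e` everywhere, so `e` could be
deleted. -/
lemma HasEnds.isAcyclic_of_minimal (h : G.HasEnds a b)
    (hmin : ∀ e ∈ E(G), ¬ (G.deleteEdges {e}).Connected) (hc : G.Connected) : G.IsAcyclic := by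
  intro e x y he hr
  have hd := h.of_le (deleteEdges_le (F := {e}))
  rw [hd.reachable_iff] at hr
  refine hmin e he.edge_mem ⟨hc.1, fun u hu v hv => ?_⟩
  rw [hd.reachable_iff]
  refine Conn.lift (r := Conn a b E(G.deleteEdges {e}))
    ⟨fun _ => Conn.refl _ _, fun h => h.symm, fun h h' => h.trans h'⟩ ?_
    (h.reachable_iff.1 (hc.2 u hu v hv))
  intro f hf
  by_cases hfe : f = e
  · subst hfe
    rcases (h f hf).eq_and_eq_or_eq_and_eq he with ⟨h1, h2⟩ | ⟨h1, h2⟩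
    · rw [h1, h2]; exact hr
    · rw [h1, h2]; exact hr.symm
  · exact Conn.edge (by simp [hf, hfe])

/-- A connected graph with finitely many edges has a spanning tree. -/
lemma HasEnds.exists_isTree (h : G.HasEnds a b) (F : Finset β)
    (hc : (G.restrict (F : Set β)).Connected) :
    ∃ F' ⊆ F, (G.restrict (F' : Set β)).IsTree := by
  induction F using Finset.strongInduction with
  | H F ih =>
    by_cases hF : ∃ e ∈ F, (G.restrict ((F.erase e : Finset β) : Set β)).Connected
    · obtain ⟨e, he, he'⟩ := hF
      obtain ⟨F', h1, h2⟩ := ih _ (Finset.erase_ssubset he) he'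
      exact ⟨F', h1.trans (Finset.erase_subset _ _), h2⟩
    · push Not at hF
      refine ⟨F, subset_rfl, hc,
        (h.of_le restrict_le).isAcyclic_of_minimal (fun e he hc' => hF e he.2 ?_) hc⟩
      convert hc' using 1
      rw [← restrict_edgeSet_sdiff_eq_deleteEdges, restrict_restrict]
      refine Graph.ext rfl fun f x y => ?_
      simp only [restrict_isLink, Finset.coe_erase, edgeSet_restrict, Set.mem_sdiff,
        Set.mem_inter_iff, Finset.mem_coe, Set.mem_singleton_iff]
      exact ⟨fun ⟨h1, h2⟩ => ⟨⟨h1.1, ⟨h2.edge_mem, h1.1⟩, h1.2⟩, h2⟩,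
        fun ⟨h1, h2⟩ => ⟨⟨h1.1, h1.2.2⟩, h2⟩⟩

lemma HasEnds.isTreeConnected (h : G.HasEnds a b) {E : Finset β} (hE : (E : Set β) ⊆ E(G))
    (hne : V(G).Nonempty) {F : Fin m → Finset β} (hF : IsPacking E F)
    (hc : ∀ j, ∀ x ∈ V(G), ∀ y ∈ V(G), Conn a b (F j : Set β) x y) : IsTreeConnected m G := by
  have h1 : ∀ j, ∃ F' ⊆ F j, (G.restrict (F' : Set β)).IsTree := by
    intro j
    refine h.exists_isTree (F j) ⟨hne, fun x hx y hy => ?_⟩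
    rw [(h.of_le restrict_le).reachable_iff]
    refine (hc j x hx y hy).mono fun e he => ?_
    exact ⟨hE (hF.1 j he), he⟩
  choose F' hF' hT using h1
  refine ⟨fun j => G.restrict (F' j : Set β), fun j => ⟨⟨restrict_le, rfl⟩, hT j⟩, ?_⟩
  intro i j hij
  refine Set.disjoint_left.2 fun e he he' => ?_
  exact Finset.disjoint_left.1 (hF.2 i j hij) (hF' i he.2) (hF' j he'.2)

lemma HasEnds.exists_packing (h : G.HasEnds a b) {E : Finset β} (hE : E(G) = E)
    (ht : IsTreeConnected m G) :
    ∃ F : Fin m → Finset β, IsPacking E F ∧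
      ∀ j, ∀ x ∈ V(G), ∀ y ∈ V(G), Conn a b (F j : Set β) x y := by
  obtain ⟨T, hT, hd⟩ := ht
  have hsub : ∀ j, E(T j) ⊆ (E : Set β) := fun j => hE ▸ (hT j).1.le.edgeSet_mono
  have hF : ∀ j, ((E.filter fun e => e ∈ E(T j) : Finset β) : Set β) = E(T j) := fun j => by
    ext e
    simpa using fun he => hsub j he
  refine ⟨fun j => E.filter fun e => e ∈ E(T j), ⟨fun j => Finset.filter_subset _ _, ?_⟩, ?_⟩
  · intro i j hij
    rw [← Finset.disjoint_coe, hF, hF]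
    exact hd hij
  · intro j x hx y hy
    rw [hF, ← (h.of_le (hT j).1.le).reachable_iff]
    have hV := (hT j).1.vertexSet_eq
    exact (hT j).2.1.2 x (hV ▸ hx) y (hV ▸ hy)

lemma IsTreeConnected.nonempty (hm : 1 ≤ m) (h : IsTreeConnected m G) : V(G).Nonempty := by
  obtain ⟨T, hT, -⟩ := h
  obtain ⟨x, hx⟩ := (hT ⟨0, hm⟩).2.1.1
  exact ⟨x, (hT ⟨0, hm⟩).1.le.vertexSet_mono hx⟩

lemma HasEnds.mem_vertexSet (h : G.HasEnds a b) {e : β} (he : e ∈ E(G)) :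
    a e ∈ V(G) ∧ b e ∈ V(G) :=
  ⟨(h e he).left_mem, (h e he).right_mem⟩

lemma HasEnds.edgeSet_induce (h : G.HasEnds a b) {E : Finset β} (hE : E(G) = E) (Y : Finset α) :
    E(G.induce (Y : Set α)) = inside a b E Y := by
  ext e
  simp only [Graph.edgeSet_induce, Set.mem_ofPred_eq, Finset.mem_coe, mem_inside]
  constructor
  · rintro ⟨x, y, he, hx, hy⟩
    have he' : e ∈ E := by rw [← Finset.mem_coe, ← hE]; exact he.edge_mem
    rcases (h e he.edge_mem).eq_and_eq_or_eq_and_eq he with ⟨h1, h2⟩ | ⟨h1, h2⟩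
    · rw [h1, h2]; exact ⟨he', hx, hy⟩
    · rw [h1, h2]; exact ⟨he', hy, hx⟩
  · rintro ⟨he, hx, hy⟩
    exact ⟨a e, b e, h e (by rw [hE]; exact he), hx, hy⟩

/-- `I` is a sparse edge set of `G`, and the ends of each other edge are in a common tight set. -/
structure IsSparseBasis (m : ℕ) (G : Graph α β) (a b : β → α) (V : Finset α) (E I : Finset β) :
    Prop where
  hasEnds : G.HasEnds a b
  vertexSet_eq : V(G) = V
  edgeSet_eq : E(G) = E
  subset : I ⊆ E
  sparse : Sparse a b m I
  exists_tight : ∀ e ∈ E, e ∉ I → ∃ X ⊆ V, Tight a b m I X ∧ a e ∈ X ∧ b e ∈ X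

lemma exists_isSparseBasis (m : ℕ) (h : G.HasEnds a b) {V : Finset α} {E : Finset β}
    (hV : V(G) = V) (hE : E(G) = E) : ∃ I, IsSparseBasis m G a b V E I := by
  obtain ⟨I, h1, h2, h3⟩ := exists_maximal_sparse (a := a) (b := b) (E := E) (V := V) m
    fun e he => by
      have := h.mem_vertexSet (e := e) (by rw [hE]; exact he)
      rwa [hV] at this
  exact ⟨I, h, hV, hE, h1, h2, h3⟩

namespace IsSparseBasis

variable {V : Finset α} {E I : Finset β}

lemma mem_vertices (h : IsSparseBasis m G a b V E I) {e : β} (he : e ∈ E) : a e ∈ V ∧ b e ∈ V := by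
  have := h.hasEnds.mem_vertexSet (e := e) (by rw [h.edgeSet_eq]; exact he)
  rwa [h.vertexSet_eq] at this

lemma isTreeConnected_of_tight (h : IsSparseBasis m G a b V E I) {X : Finset α} (hXV : X ⊆ V)
    (hX : Tight a b m I X) : IsTreeConnected m (G.induce (X : Set α)) := by
  obtain ⟨F, hF, hc⟩ := h.sparse.exists_packing_of_tight hX
  have hle : G.induce (X : Set α) ≤ G :=
    induce_le (by rw [h.vertexSet_eq]; exact_mod_cast hXV)
  refine (h.hasEnds.of_le hle).isTreeConnected (E := inside a b I X) ?_ hX.1 hF hc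
  rw [h.hasEnds.edgeSet_induce h.edgeSet_eq]
  exact_mod_cast Finset.filter_subset_filter _ h.subset

lemma subset_part (h : IsSparseBasis m G a b V E I) {Y : Set α} (hY : Y ⊆ V(G))
    (ht : IsTreeConnected m (G.induce Y)) {x : α} (hx : x ∈ Y) :
    Y ⊆ part a b m I V x := by
  have hY' := hY
  rw [h.vertexSet_eq] at hY
  lift Y to Finset α using V.finite_toSet.subset hY
  obtain ⟨F, hF, hc⟩ := (h.hasEnds.of_le (induce_le hY')).exists_packing
    (h.hasEnds.edgeSet_induce h.edgeSet_eq Y) ht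
  exact_mod_cast h.sparse.subset_part_of_packing h.exists_tight (by exact_mod_cast hY) hF hc hx

/-- Tight sets induce `m`-tree-connected subgraphs by the packing theorem; conversely,
`m`-tree-connected sets lie in maximal tight sets. -/
lemma treeComponentSets_eq (h : IsSparseBasis m G a b V E I) (hm : 1 ≤ m) :
    treeComponentSets m G = (parts a b m I V).image (fun X : Finset α => (X : Set α)) := by
  ext Y
  simp only [treeComponentSets, Set.mem_ofPred_eq, Finset.coe_image, Set.mem_image, Finset.mem_coe]
  have hpart : ∀ x ∈ V, ((part a b m I V x : Finset α) : Set α) ⊆ V(G) ∧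
      IsTreeConnected m (G.induce (part a b m I V x : Set α)) := fun x hx => by
    obtain ⟨h1, h2, h3⟩ := h.sparse.part_spec hx
    exact ⟨by rw [h.vertexSet_eq]; exact_mod_cast h3, h.isTreeConnected_of_tight h3 h1⟩
  constructor
  · intro hY
    obtain ⟨x, hx⟩ : Y.Nonempty := hY.1.2.nonempty hm
    have hxV : x ∈ V := by
      have := hY.1.1 hx
      rwa [h.vertexSet_eq] at this
    refine ⟨part a b m I V x, mem_parts.2 ⟨x, hxV, rfl⟩, ?_⟩
    have := h.subset_part hY.1.1 hY.1.2 hx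
    exact (hY.2 (hpart x hxV) this).antisymm this
  · rintro ⟨X, hX, rfl⟩
    obtain ⟨x, hx, rfl⟩ := mem_parts.1 hX
    exact ⟨hpart x hx, fun Y hY hle =>
      h.subset_part hY.1 hY.2 (hle (h.sparse.part_spec hx).2.1)⟩

lemma mem_crossingEdges (h : IsSparseBasis m G a b V E I) (hm : 1 ≤ m) {e : β} :
    e ∈ G.crossingEdges (treeComponentSets m G) ↔
      e ∈ E ∧ part a b m I V (a e) ≠ part a b m I V (b e) := by
  rw [h.treeComponentSets_eq hm]
  simp only [crossingEdges, Finset.coe_image, Set.mem_image, Finset.mem_coe, Set.mem_ofPred_eq,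
    exists_exists_and_eq_and, ne_eq, Finset.coe_inj]
  constructor
  · rintro ⟨x, y, he, A, hA, B, hB, hAB, hx, hy⟩
    have he' : e ∈ E := by rw [← Finset.mem_coe, ← h.edgeSet_eq]; exact he.edge_mem
    refine ⟨he', ?_⟩
    have hx' := h.sparse.part_eq_of_mem_parts hA hx
    have hy' := h.sparse.part_eq_of_mem_parts hB hy
    rcases (h.hasEnds e he.edge_mem).eq_and_eq_or_eq_and_eq he with ⟨h1, h2⟩ | ⟨h1, h2⟩
    · rwa [h1, h2, hx', hy']
    · rw [h1, h2, hx', hy']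
      exact fun h => hAB h.symm
  · rintro ⟨he, hne⟩
    obtain ⟨ha, hb⟩ := h.mem_vertices he
    exact ⟨a e, b e, h.hasEnds e (by rw [h.edgeSet_eq]; exact he), _, mem_parts.2 ⟨_, ha, rfl⟩, _,
      mem_parts.2 ⟨_, hb, rfl⟩, hne, (h.sparse.part_spec ha).2.1, (h.sparse.part_spec hb).2.1⟩

lemma ncard_crossingEdges (h : IsSparseBasis m G a b V E I) (hm : 1 ≤ m) :
    (G.crossingEdges (treeComponentSets m G)).ncard =
      (E.filter fun e => part a b m I V (a e) ≠ part a b m I V (b e)).card := by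
  rw [← Set.ncard_coe_finset]
  congr 1
  ext e
  rw [h.mem_crossingEdges hm]
  simp

lemma ncard_treeComponentSets (h : IsSparseBasis m G a b V E I) (hm : 1 ≤ m) :
    (treeComponentSets m G).ncard = (parts a b m I V).card := by
  rw [h.treeComponentSets_eq hm, Set.ncard_coe_finset,
    Finset.card_image_of_injective _ Finset.coe_injective]

/-- All edges between different maximal tight sets belong to the sparse set. -/
lemma filter_part_eq (h : IsSparseBasis m G a b V E I) :
    (E.filter fun e => part a b m I V (a e) ≠ part a b m I V (b e)) =
      I.filter fun e => part a b m I V (a e) ≠ part a b m I V (b e) := by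
  ext e
  simp only [Finset.mem_filter, and_congr_left_iff]
  refine fun hne => ⟨fun he => ?_, fun he => h.subset he⟩
  by_contra hn
  obtain ⟨X, hXV, hX, h3, h4⟩ := h.exists_tight e he hn
  exact hne (h.sparse.part_eq (hXV h4) (hX.subset_part hXV h4 h3))

lemma card_add (h : IsSparseBasis m G a b V E I) :
    I.card + m * (parts a b m I V).card = m * V.card +
      (E.filter fun e => part a b m I V (a e) ≠ part a b m I V (b e)).card := by
  have h1 := h.sparse.card_inside_biUnion (subset_refl (parts a b m I V))
  rw [h.sparse.biUnion_parts] at h1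
  have h2 : inside a b I V = I := Finset.filter_true_of_mem fun e he => h.mem_vertices (h.subset he)
  rw [h2] at h1
  rw [h1, h.filter_part_eq]

/-- Each part X spans m(|X| - 1) edges of `I`, and all crossing edges belong to `I`. The partition
thus disappears from `Omega`, which can be read off from any sparse basis. -/
lemma mul_Omega (h : IsSparseBasis m G a b V E I) (hm : 1 ≤ m) :
    (m : ℝ) * Omega m G = m * V.card - I.card := by
  have h1 := h.card_add
  have hm' : (m : ℝ) ≠ 0 := by positivity
  rw [Omega, h.ncard_treeComponentSets hm, h.ncard_crossingEdges hm]
  have h2 : (I.card : ℝ) + m * (parts a b m I V).card = m * V.card +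
      (E.filter fun e => part a b m I V (a e) ≠ part a b m I V (b e)).card := by
    exact_mod_cast h1
  field_simp
  linarith

end IsSparseBasis

end Graph

end

/-! ### Lowering degrees by exchanges in a base of minimum excess. -/

section

open scoped Classical

namespace EdgeEnds

variable {α β : Type*} (a b : β → α)

/-- The degree of `v` in the edge set `H` (without loops). -/
noncomputable def deg (H : Finset β) (v : α) : ℕ :=
  (H.filter fun e => a e = v ∨ b e = v).card

/-- A sparse subset of `E` with `m (|V| - 1)` edges. -/
structure IsBase (m : ℕ) (E : Finset β) (V : Finset α) (H : Finset β) : Prop where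
  subset : H ⊆ E
  sparse : Sparse a b m H
  card_add : H.card + m = m * V.card

/-- `K` and `H` have the same edges, except possibly for edges with both ends in `X`. -/
def AgreeOff (X : Finset α) (K H : Finset β) : Prop :=
  ∀ e, ¬ (a e ∈ X ∧ b e ∈ X) → (e ∈ K ↔ e ∈ H)

/-- The edge set that equals `K₂` inside `Y` and `K₁` elsewhere. -/
noncomputable def swap (K₁ K₂ : Finset β) (Y : Finset α) : Finset β :=
  (K₁.filter fun e => ¬ (a e ∈ Y ∧ b e ∈ Y)) ∪ inside a b K₂ Y

variable {a b} {m : ℕ} {E H K K₁ K₂ : Finset β} {V X Y Z Q : Finset α}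

lemma mem_swap_of_inside {e : β} (he : a e ∈ Y ∧ b e ∈ Y) : e ∈ swap a b K₁ K₂ Y ↔ e ∈ K₂ := by
  simp [swap, mem_inside, he]

lemma mem_swap_of_not_inside {e : β} (he : ¬ (a e ∈ Y ∧ b e ∈ Y)) :
    e ∈ swap a b K₁ K₂ Y ↔ e ∈ K₁ := by
  simp only [swap, mem_inside, Finset.mem_union, Finset.mem_filter]
  tauto

lemma swap_subset (h₁ : K₁ ⊆ E) (h₂ : K₂ ⊆ E) : swap a b K₁ K₂ Y ⊆ E :=
  Finset.union_subset ((Finset.filter_subset _ _).trans h₁) (inside_subset.trans h₂)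

lemma card_inside_add_card_outside (X : Finset α) :
    (inside a b H X).card + (H.filter fun e => ¬ (a e ∈ X ∧ b e ∈ X)).card = H.card :=
  Finset.card_filter_add_card_filter_not _

lemma card_swap (h : (inside a b K₁ Y).card = (inside a b K₂ Y).card) :
    (swap a b K₁ K₂ Y).card = K₁.card := by
  rw [swap, Finset.card_union_of_disjoint, ← card_inside_add_card_outside (H := K₁) Y, h, add_comm]
  refine Finset.disjoint_left.2 fun e he he' => ?_
  exact (Finset.mem_filter.1 he).2 (mem_inside.1 he').2

/-- Replacing the edges inside a tight set by those of another sparse set gives a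
sparse set. -/
lemma Sparse.swap (h₁ : Sparse a b m K₁) (h₂ : Sparse a b m K₂) (hY₁ : Tight a b m K₁ Y) :
    Sparse a b m (swap a b K₁ K₂ Y) := by
  intro Z hZ
  let R := (inside a b K₁ Z).filter fun e => ¬ (a e ∈ Y ∧ b e ∈ Y)
  have hsplit : (inside a b (EdgeEnds.swap a b K₁ K₂ Y) Z).card ≤
      R.card + (inside a b K₂ (Z ∩ Y)).card := by
    refine (Finset.card_le_card ?_).trans (Finset.card_union_le _ _)
    intro e he
    rw [mem_inside] at he
    by_cases hY : a e ∈ Y ∧ b e ∈ Y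
    · refine Finset.mem_union_right _ (mem_inside.2 ⟨(mem_swap_of_inside hY).1 he.1, ?_⟩)
      simp [he.2, hY]
    · refine Finset.mem_union_left _ (Finset.mem_filter.2 ⟨mem_inside.2 ⟨?_, he.2⟩, hY⟩)
      exact (mem_swap_of_not_inside hY).1 he.1
  rcases (Z ∩ Y).eq_empty_or_nonempty with hem | hne
  · have h3 : (inside a b K₂ (Z ∩ Y)).card = 0 := by simp [hem, inside]
    have h4 : R.card ≤ (inside a b K₁ Z).card := Finset.card_filter_le _ _
    have h5 := h₁ Z hZ
    omega
  · have h3 := h₂ _ hne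
    have h4 : R.card + (inside a b K₁ Y).card ≤ (inside a b K₁ (Z ∪ Y)).card := by
      rw [← Finset.card_union_of_disjoint]
      · refine Finset.card_le_card (Finset.union_subset ((Finset.filter_subset _ _).trans
          (inside_mono Finset.subset_union_left)) (inside_mono Finset.subset_union_right))
      · refine Finset.disjoint_left.2 fun e he he' => ?_
        exact (Finset.mem_filter.1 he).2 (mem_inside.1 he').2
    have h5 := h₁ _ (hZ.mono (Finset.subset_union_left (s₂ := Y)))
    have h6 := hY₁.2
    have h7 : m * (Z ∪ Y).card + m * (Z ∩ Y).card = m * Z.card + m * Y.card := by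
      rw [← mul_add, ← mul_add, Finset.card_union_add_card_inter]
    omega

lemma AgreeOff.mono (h : AgreeOff a b X K H) (hX : X ⊆ Y) : AgreeOff a b Y K H := fun e he =>
  h e fun h' => he ⟨hX h'.1, hX h'.2⟩

lemma AgreeOff.card_inside (h : AgreeOff a b X K H) (hc : K.card = H.card) :
    (inside a b K X).card = (inside a b H X).card := by
  have h1 := card_inside_add_card_outside (a := a) (b := b) (H := K) X
  have h2 := card_inside_add_card_outside (a := a) (b := b) (H := H) X
  have h3 : (K.filter fun e => ¬ (a e ∈ X ∧ b e ∈ X)) =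
      H.filter fun e => ¬ (a e ∈ X ∧ b e ∈ X) := by
    ext e
    simp only [Finset.mem_filter, and_congr_left_iff]
    exact fun he => h e he
  rw [h3] at h1
  omega

lemma AgreeOff.tight_iff (h : AgreeOff a b X K H) (hc : K.card = H.card) (hX : X ⊆ Z) :
    Tight a b m K Z ↔ Tight a b m H Z := by
  rw [Tight, Tight, (h.mono hX).card_inside hc]

lemma deg_congr {v : α} (h : ∀ e, a e = v ∨ b e = v → (e ∈ K ↔ e ∈ H)) :
    deg a b K v = deg a b H v := by
  unfold deg
  congr 1
  ext e
  simp only [Finset.mem_filter, and_congr_left_iff]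
  exact h e

lemma AgreeOff.deg_eq (h : AgreeOff a b X K H) {v : α} (hv : v ∉ X) :
    deg a b K v = deg a b H v := by
  refine deg_congr fun e he => h e ?_
  rintro ⟨h1, h2⟩
  rcases he with rfl | rfl
  · exact hv h1
  · exact hv h2

/-- Tight sets through `x` are closed under intersection. The edges inside `Q` are candidates for
replacement by an edge joining `x` and `y`, as in `Sparse.exchange`. -/
lemma Sparse.exists_minimal_tight (hH : Sparse a b m H) {x y : α} (hV : Tight a b m H V)
    (hx : x ∈ V) (hy : y ∈ V) : ∃ Q, Tight a b m H Q ∧ x ∈ Q ∧ y ∈ Q ∧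
      ∀ X, Tight a b m H X → x ∈ X → y ∈ X → Q ⊆ X := by
  obtain ⟨Q, hQ, hmin⟩ := (V.powerset.filter
    fun X => Tight a b m H X ∧ x ∈ X ∧ y ∈ X).exists_min_image Finset.card
      ⟨V, by simp [hV, hx, hy]⟩
  simp only [Finset.mem_filter, Finset.mem_powerset] at hQ hmin
  refine ⟨Q, hQ.2.1, hQ.2.2.1, hQ.2.2.2, fun X hX hxX hyX => ?_⟩
  have hxQX := Finset.mem_inter.2 ⟨hQ.2.2.1, hxX⟩
  have h1 := (hH.tight_union_inter hQ.2.1 hX ⟨x, hxQX⟩).2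
  have h2 := hmin (Q ∩ X) ⟨Finset.inter_subset_left.trans hQ.1, h1, hxQX,
    Finset.mem_inter.2 ⟨hQ.2.2.2, hyX⟩⟩
  exact Finset.inter_eq_left.1 (Finset.eq_of_subset_of_card_le Finset.inter_subset_left h2)

/-- An edge between two vertices can be exchanged for any edge inside the smallest tight set that
contains these vertices. -/
lemma Sparse.exchange (hH : Sparse a b m H) {e f : β}
    (hmin : ∀ X, Tight a b m H X → a e ∈ X → b e ∈ X → Q ⊆ X) (hf : f ∈ inside a b H Q) :
    Sparse a b m (insert e (H.erase f)) := by
  intro X hX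
  have h1 := hH X hX
  by_cases hab : a e ∈ X ∧ b e ∈ X
  · have h2 : inside a b (insert e (H.erase f)) X ⊆ insert e ((inside a b H X).erase f) := by
      intro g hg
      simp only [mem_inside, Finset.mem_insert, Finset.mem_erase] at hg ⊢
      tauto
    have h3 := (Finset.card_le_card h2).trans (Finset.card_insert_le _ _)
    by_cases ht : Tight a b m H X
    · have hfX : f ∈ inside a b H X := inside_mono (hmin X ht hab.1 hab.2) hf
      have h4 := Finset.card_erase_add_one hfX
      omega
    · have h4 : (inside a b H X).card + m ≠ m * X.card := fun h => ht ⟨hX, h⟩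
      have h5 := Finset.card_erase_le (s := inside a b H X) (a := f)
      omega
  · have h2 : inside a b (insert e (H.erase f)) X ⊆ inside a b H X := by
      intro g hg
      simp only [mem_inside, Finset.mem_insert, Finset.mem_erase] at hg ⊢
      rcases hg.1 with rfl | h
      · exact absurd hg.2 hab
      · exact ⟨h.2, hg.2⟩
    exact le_trans (by gcongr) h1

lemma IsBase.tight (h : IsBase a b m E V H) (hE : ∀ e ∈ E, a e ∈ V ∧ b e ∈ V)
    (hV : V.Nonempty) : Tight a b m H V := by
  refine ⟨hV, ?_⟩
  rw [← h.card_add, inside, Finset.filter_true_of_mem fun e he => hE e (h.subset he)]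

lemma IsBase.exchange (hH : IsBase a b m E V H) {e f : β} (he : e ∈ E) (heH : e ∉ H)
    (hmin : ∀ X, Tight a b m H X → a e ∈ X → b e ∈ X → Q ⊆ X) (hf : f ∈ inside a b H Q) :
    IsBase a b m E V (insert e (H.erase f)) := by
  have hfH := (mem_inside.1 hf).1
  refine ⟨Finset.insert_subset he ((Finset.erase_subset _ _).trans hH.subset),
    hH.sparse.exchange hmin hf, ?_⟩
  rw [Finset.card_insert_of_notMem fun h => heH (Finset.mem_of_mem_erase h),
    Finset.card_erase_add_one hfH]
  exact hH.card_add

/-- Every vertex of a tight set with at least two vertices is incident to an edge inside it. -/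
lemma Sparse.exists_edge_of_tight (hm : 1 ≤ m) (hH : Sparse a b m H) (hQ : Tight a b m H Q)
    {u x : α} (hu : u ∈ Q) (hx : x ∈ Q) (hux : u ≠ x) :
    ∃ f ∈ inside a b H Q, a f = u ∨ b f = u := by
  by_contra! hc
  have h1 : inside a b H Q ⊆ inside a b H (Q.erase u) := by
    intro f hf
    have := hc f hf
    rw [mem_inside] at hf ⊢
    simp [hf, this]
  have h2 := Finset.card_le_card h1
  have h3 := hH (Q.erase u) ⟨x, Finset.mem_erase.2 ⟨hux.symm, hx⟩⟩
  have h4 := hQ.2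
  have h5 := Finset.card_erase_add_one hu
  have h6 : m * Q.card = m * (Q.erase u).card + m := by rw [← h5]; ring
  omega

lemma deg_exchange_le_add_one {e f : β} {v : α} :
    deg a b (insert e (H.erase f)) v ≤ deg a b H v + 1 := by
  refine (Finset.card_le_card ?_).trans (Finset.card_insert_le e _)
  intro g
  simp only [Finset.mem_filter, Finset.mem_insert, Finset.mem_erase]
  tauto

lemma filter_exchange_subset {e f : β} {v : α} (ha : a e ≠ v) (hb : b e ≠ v) :
    ((insert e (H.erase f)).filter fun g => a g = v ∨ b g = v) ⊆
      (H.filter fun g => a g = v ∨ b g = v).erase f := by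
  intro g
  simp only [Finset.mem_filter, Finset.mem_insert, Finset.mem_erase]
  rintro ⟨rfl | h, h'⟩
  · tauto
  · tauto

lemma deg_exchange_le {e f : β} {v : α} (ha : a e ≠ v) (hb : b e ≠ v) :
    deg a b (insert e (H.erase f)) v ≤ deg a b H v :=
  Finset.card_le_card ((filter_exchange_subset ha hb).trans (Finset.erase_subset _ _))

lemma deg_exchange_lt {e f : β} {v : α} (ha : a e ≠ v) (hb : b e ≠ v) (hf : f ∈ H)
    (hfv : a f = v ∨ b f = v) : deg a b (insert e (H.erase f)) v < deg a b H v := by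
  refine (Finset.card_le_card (filter_exchange_subset ha hb)).trans_lt ?_
  exact Finset.card_erase_lt_of_mem (Finset.mem_filter.2 ⟨hf, hfv⟩)

variable (a b) in
/-- The degree of `v` can be made smaller than `η` by a change of the base `H` inside a tight set
that avoids `U`, such that no degree in this set exceeds `η` afterwards. -/
def Reducible (m η : ℕ) (E : Finset β) (V : Finset α) (H : Finset β) (U : Finset α) (v : α) : Prop :=
  ∃ K X, IsBase a b m E V K ∧ Tight a b m H X ∧ X ⊆ V ∧ Disjoint X U ∧ v ∈ X ∧
    AgreeOff a b X K H ∧ (∀ w ∈ X, deg a b K w ≤ η) ∧ deg a b K v < η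

variable (a b) in
/-- The vertices of degree more than `η`, and then repeatedly the vertices that are not reducible
with respect to the previous set. -/
noncomputable def obstruction (m η : ℕ) (E : Finset β) (V : Finset α) (H : Finset β) :
    ℕ → Finset α
  | 0 => V.filter fun v => η < deg a b H v
  | n + 1 => V.filter fun v => ¬ Reducible a b m η E V H (obstruction m η E V H n) v

variable {η : ℕ}

lemma obstruction_subset (n : ℕ) : obstruction a b m η E V H n ⊆ V := by
  cases n <;> exact Finset.filter_subset _ _

lemma obstruction_mono : Monotone (obstruction a b m η E V H) := by
  refine monotone_nat_of_le_succ fun n v hv => ?_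
  refine Finset.mem_filter.2 ⟨obstruction_subset n hv, ?_⟩
  rintro ⟨K, X, -, -, -, hd, hvX, -⟩
  exact Finset.disjoint_left.1 hd hvX hv

lemma exists_obstruction_stable :
    ∃ n, obstruction a b m η E V H (n + 1) = obstruction a b m η E V H n := by
  by_contra! hc
  have h : ∀ n, n ≤ (obstruction a b m η E V H n).card := by
    intro n
    induction n with
    | zero => simp
    | succ n ih =>
      refine ih.trans_lt (Finset.card_lt_card (lt_of_le_of_ne (obstruction_mono n.le_succ) ?_))
      exact (hc n).symm
  have h1 := h (V.card + 1)
  have h2 := Finset.card_le_card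
    (obstruction_subset (a := a) (b := b) (m := m) (η := η) (E := E) (V := V) (H := H) (V.card + 1))
  omega

/-- A vertex of degree below `η` outside the previous set is reducible with no change at all, within
the tight set `{v}`; so it never enters. -/
lemma IsBase.le_deg_of_mem_obstruction (hH : IsBase a b m E V H) {n : ℕ} {v : α}
    (hv : v ∈ obstruction a b m η E V H n) : η ≤ deg a b H v := by
  induction n with
  | zero => exact (Finset.mem_filter.1 hv).2.le
  | succ n ih =>
    by_cases hvn : v ∈ obstruction a b m η E V H n
    · exact ih hvn
    · by_contra! hlt
      refine (Finset.mem_filter.1 hv).2 ⟨H, {v}, hH, hH.sparse.tight_singleton v,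
        by simpa using obstruction_subset _ hv, by simpa using hvn, by simp, fun _ _ => Iff.rfl,
        ?_, hlt⟩
      simpa using hlt.le

variable (a b) in
/-- The total amount by which degrees exceed `η`. -/
noncomputable def excess (η : ℕ) (V : Finset α) (H : Finset β) : ℕ :=
  ∑ v ∈ V, (deg a b H v - η)

/-- Two vertices that are reducible within disjoint tight sets can be made smaller at once. -/
lemma IsBase.exists_combined (hH : IsBase a b m E V H) (h₁ : IsBase a b m E V K₁)
    (h₂ : IsBase a b m E V K₂) (hX : Tight a b m H X) (hY : Tight a b m H Y)
    (hXY : Disjoint X Y) (hX₁ : AgreeOff a b X K₁ H) (hY₂ : AgreeOff a b Y K₂ H) :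
    ∃ K, IsBase a b m E V K ∧ Tight a b m K X ∧ Tight a b m K Y ∧
      (∀ e, ¬ (a e ∈ X ∧ b e ∈ X) → ¬ (a e ∈ Y ∧ b e ∈ Y) → (e ∈ K ↔ e ∈ H)) ∧
      (∀ v ∈ X, deg a b K v = deg a b K₁ v) ∧ (∀ v ∈ Y, deg a b K v = deg a b K₂ v) := by
  have hc₁ : K₁.card = H.card := by have := h₁.card_add; have := hH.card_add; omega
  have hc₂ : K₂.card = H.card := by have := h₂.card_add; have := hH.card_add; omega
  have hnX : ∀ e, a e ∈ Y ∨ b e ∈ Y → ¬ (a e ∈ X ∧ b e ∈ X) := by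
    rintro e (h | h) ⟨h3, h4⟩
    · exact Finset.disjoint_left.1 hXY h3 h
    · exact Finset.disjoint_left.1 hXY h4 h
  have hin : inside a b K₁ Y = inside a b H Y := by
    ext e
    simp only [mem_inside, and_congr_left_iff]
    exact fun h => hX₁ e (hnX e (Or.inl h.1))
  have hY₁' : Tight a b m K₁ Y := by rw [Tight, hin]; exact hY
  have hY₂' : Tight a b m K₂ Y := (hY₂.tight_iff hc₂ subset_rfl).2 hY
  have hX₁' : Tight a b m K₁ X := (hX₁.tight_iff hc₁ subset_rfl).2 hX
  refine ⟨EdgeEnds.swap a b K₁ K₂ Y, ⟨swap_subset h₁.subset h₂.subset,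
    h₁.sparse.swap h₂.sparse hY₁', ?_⟩, ?_, ?_, ?_, ?_, ?_⟩
  · rw [card_swap (by rw [hin, hY₂.card_inside hc₂])]
    exact h₁.card_add
  · have : inside a b (EdgeEnds.swap a b K₁ K₂ Y) X = inside a b K₁ X := by
      ext e
      simp only [mem_inside, and_congr_left_iff]
      exact fun h => mem_swap_of_not_inside fun h' => Finset.disjoint_left.1 hXY h.1 h'.1
    rw [Tight, this]; exact hX₁'
  · have : inside a b (EdgeEnds.swap a b K₁ K₂ Y) Y = inside a b K₂ Y := by
      ext e
      simp only [mem_inside, and_congr_left_iff]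
      exact fun h => mem_swap_of_inside h
    rw [Tight, this]; exact hY₂'
  · intro e hX' hY'
    rw [mem_swap_of_not_inside hY', hX₁ e hX']
  · intro v hv
    refine deg_congr fun e he => mem_swap_of_not_inside ?_
    rintro ⟨h3, h4⟩
    rcases he with rfl | rfl
    · exact Finset.disjoint_left.1 hXY hv h3
    · exact Finset.disjoint_left.1 hXY hv h4
  · intro v hv
    refine deg_congr fun e he => ?_
    by_cases hY' : a e ∈ Y ∧ b e ∈ Y
    · exact mem_swap_of_inside hY'
    · rw [mem_swap_of_not_inside hY', hX₁ e (hnX e ?_), hY₂ e hY']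
      rcases he with rfl | rfl
      · exact Or.inl hv
      · exact Or.inr hv

/-- In a base with minimum excess, the ends of an edge outside the base that are both reducible are
in a common tight set that avoids the obstruction. -/
lemma IsBase.exists_tight_of_reducible (hm : 1 ≤ m) (hE : ∀ e ∈ E, a e ∈ V ∧ b e ∈ V)
    (hH : IsBase a b m E V H)
    (hmin : ∀ K, IsBase a b m E V K → excess a b η V H ≤ excess a b η V K) {n : ℕ} {e : β}
    (he : e ∈ E) (heH : e ∉ H)
    (hae : Reducible a b m η E V H (obstruction a b m η E V H n) (a e))
    (hbe : Reducible a b m η E V H (obstruction a b m η E V H n) (b e)) :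
    ∃ Z ⊆ V, Disjoint Z (obstruction a b m η E V H n) ∧ Tight a b m H Z ∧ a e ∈ Z ∧ b e ∈ Z := by
  set U := obstruction a b m η E V H with hU
  obtain ⟨K₁, X, h₁, hX, hXV, hXU, haX, hX₁, hd₁, hd₁'⟩ := hae
  obtain ⟨K₂, Y, h₂, hY, hYV, hYU, hbY, hY₂, hd₂, hd₂'⟩ := hbe
  by_cases hXY : (X ∩ Y).Nonempty
  · exact ⟨X ∪ Y, Finset.union_subset hXV hYV, Finset.disjoint_union_left.2 ⟨hXU, hYU⟩,
      hH.sparse.tight_union hX hY hXY, Finset.mem_union_left _ haX, Finset.mem_union_right _ hbY⟩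
  -- Both reductions are performed at once: in `L` both ends of `e` have degree below `η`, which
  -- leaves room to add `e`.
  rw [Finset.not_nonempty_iff_eq_empty, ← Finset.disjoint_iff_inter_eq_empty] at hXY
  obtain ⟨L, hL, hLX, hLY, hLH', hLd₁, hLd₂⟩ :=
    hH.exists_combined h₁ h₂ hX hY hXY hX₁ hY₂
  have hLH : AgreeOff a b (X ∪ Y) L H := fun g hg => hLH' g
    (fun h => hg ⟨Finset.mem_union_left _ h.1, Finset.mem_union_left _ h.2⟩)
    (fun h => hg ⟨Finset.mem_union_right _ h.1, Finset.mem_union_right _ h.2⟩)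
  have hLc : L.card = H.card := by have := hL.card_add; have := hH.card_add; omega
  obtain ⟨haV, hbV⟩ := hE e he
  obtain ⟨Q, hQ, haQ, hbQ, hQmin⟩ := hL.sparse.exists_minimal_tight (hL.tight hE ⟨_, haV⟩) haV hbV
  have hQV : Q ⊆ V := hQmin V (hL.tight hE ⟨_, haV⟩) haV hbV
  have hZ : Tight a b m H (Q ∪ X ∪ Y) := by
    rw [← hLH.tight_iff hLc (by rw [Finset.union_assoc]; exact Finset.subset_union_right)]
    refine hL.sparse.tight_union (hL.sparse.tight_union hQ hLX ⟨a e, ?_⟩) hLY ⟨b e, ?_⟩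
    · simp [haQ, haX]
    · simp [hbQ, hbY]
  have hZV : Q ∪ X ∪ Y ⊆ V := Finset.union_subset (Finset.union_subset hQV hXV) hYV
  by_cases hQU : Disjoint Q (U n)
  · refine ⟨Q ∪ X ∪ Y, hZV, ?_, hZ, by simp [haQ], by simp [hbQ]⟩
    simp only [Finset.disjoint_union_left]
    exact ⟨⟨hQU, hXU⟩, hYU⟩
  exfalso
  -- In the first set of the chain that `Q` meets, take a vertex `u` and exchange an edge at `u` for
  -- `e`. This lowers the degree of `u`. For index 0 the excess drops below its minimum; for a later
  -- index `u` becomes reducible with respect to the preceding set, which `Q` avoids.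
  have hex : ∃ j, ¬ Disjoint Q (U j) := ⟨n, hQU⟩
  have hjn : Nat.find hex ≤ n := Nat.find_min' hex hQU
  have hj := Nat.find_spec hex
  have hjlt : ∀ i < Nat.find hex, Disjoint Q (U i) := fun i hi => not_not.1 (Nat.find_min hex hi)
  generalize Nat.find hex = j at hjn hj hjlt
  obtain ⟨u, huQ, huU⟩ := Finset.not_disjoint_iff.1 hj
  have huX : u ∉ X := fun h => Finset.disjoint_left.1 hXU h (obstruction_mono hjn huU)
  have huY : u ∉ Y := fun h => Finset.disjoint_left.1 hYU h (obstruction_mono hjn huU)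
  have hua : a e ≠ u := fun h => huX (h ▸ haX)
  have hub : b e ≠ u := fun h => huY (h ▸ hbY)
  have heL : e ∉ L := by
    rwa [hLH' e (fun h => Finset.disjoint_left.1 hXY h.2 hbY)
      (fun h => Finset.disjoint_left.1 hXY haX h.1)]
  obtain ⟨f, hf, hfu⟩ := hL.sparse.exists_edge_of_tight hm hQ huQ haQ hua.symm
  have hK := hL.exchange he heL hQmin hf
  set K := insert e (L.erase f) with hKdef
  have hdXY : ∀ w ∈ X ∪ Y, deg a b K w ≤ η := by
    intro w hw
    have hle : deg a b L w ≤ η := by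
      rcases Finset.mem_union.1 hw with h | h
      · rw [hLd₁ w h]; exact hd₁ w h
      · rw [hLd₂ w h]; exact hd₂ w h
    by_cases hwe : a e = w ∨ b e = w
    · have hlt : deg a b L w < η := by
        rcases hwe with rfl | rfl
        · rw [hLd₁ _ haX]; exact hd₁'
        · rw [hLd₂ _ hbY]; exact hd₂'
      exact deg_exchange_le_add_one.trans hlt
    · push Not at hwe
      exact (deg_exchange_le hwe.1 hwe.2).trans hle
  have hdoff : ∀ w ∉ X ∪ Y, deg a b K w ≤ deg a b H w := by
    intro w hw
    rw [← hLH.deg_eq hw]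
    refine deg_exchange_le (fun h => hw ?_) fun h => hw ?_
    · exact Finset.mem_union_left _ (h ▸ haX)
    · exact Finset.mem_union_right _ (h ▸ hbY)
  have hdu : deg a b K u < deg a b H u := by
    rw [← hLH.deg_eq (v := u) (by simp [huX, huY])]
    exact deg_exchange_lt hua hub (mem_inside.1 hf).1 hfu
  cases j with
  | zero =>
    refine (hmin K hK).not_gt (Finset.sum_lt_sum (fun w _ => ?_) ⟨u, hQV huQ, ?_⟩)
    · by_cases hw : w ∈ X ∪ Y
      · have := hdXY w hw; omega
      · have := hdoff w hw; omega
    · have : η < deg a b H u := (Finset.mem_filter.1 huU).2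
      omega
  | succ k =>
    have hZU : Disjoint (Q ∪ X ∪ Y) (U k) := by
      simp only [Finset.disjoint_union_left]
      have hkn : U k ⊆ U n := obstruction_mono (by omega)
      exact ⟨⟨hjlt k (by omega), hXU.mono_right hkn⟩, hYU.mono_right hkn⟩
    have hHη : ∀ w ∈ Q ∪ X ∪ Y, deg a b H w ≤ η := by
      intro w hw
      by_contra! hlt
      refine Finset.disjoint_left.1 hZU hw (obstruction_mono (Nat.zero_le k) ?_)
      exact Finset.mem_filter.2 ⟨hZV hw, hlt⟩
    refine (Finset.mem_filter.1 huU).2 ⟨K, Q ∪ X ∪ Y, hK, hZ, hZV, hZU, by simp [huQ], ?_, ?_, ?_⟩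
    · intro g hg
      have hge : g ≠ e := by
        rintro rfl
        exact hg ⟨by simp [haQ], by simp [hbQ]⟩
      have hgf : g ≠ f := by
        rintro rfl
        exact hg ⟨by simp [(mem_inside.1 hf).2], by simp [(mem_inside.1 hf).2]⟩
      have h3 := hLH.mono (Y := Q ∪ X ∪ Y)
        (by rw [Finset.union_assoc]; exact Finset.subset_union_right) g hg
      simp [hKdef, hge, hgf, h3]
    · intro w hw
      by_cases hw' : w ∈ X ∪ Y
      · exact hdXY w hw'
      · exact (hdoff w hw').trans (hHη w hw)
    · exact hdu.trans_le (hHη u (by simp [huQ]))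

/-- A base with minimum excess has maximum degree at most `η`, or there is a set `S` of vertices
of degree at least `η`, not all equal to `η`, such that each edge outside the base that avoids `S`
has its ends in a common tight set that avoids `S`. -/
lemma IsBase.exists_deg_le_or_obstruction (hm : 1 ≤ m) (hE : ∀ e ∈ E, a e ∈ V ∧ b e ∈ V)
    (hH : IsBase a b m E V H) (η : ℕ) :
    (∃ K, IsBase a b m E V K ∧ ∀ v ∈ V, deg a b K v ≤ η) ∨
    ∃ K S, IsBase a b m E V K ∧ S ⊆ V ∧ (∀ v ∈ S, η ≤ deg a b K v) ∧
      (∃ v ∈ S, η < deg a b K v) ∧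
      ∀ e ∈ E, e ∉ K → a e ∉ S → b e ∉ S →
        ∃ Z ⊆ V, Disjoint Z S ∧ Tight a b m K Z ∧ a e ∈ Z ∧ b e ∈ Z := by
  obtain ⟨K, hK, hmin⟩ := (E.powerset.filter fun K => IsBase a b m E V K).exists_min_image
    (excess a b η V) ⟨H, Finset.mem_filter.2 ⟨Finset.mem_powerset.2 hH.subset, hH⟩⟩
  replace hK := (Finset.mem_filter.1 hK).2
  by_cases hdeg : ∀ v ∈ V, deg a b K v ≤ η
  · exact Or.inl ⟨K, hK, hdeg⟩
  push Not at hdeg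
  obtain ⟨v, hv, hvη⟩ := hdeg
  obtain ⟨n, hn⟩ := exists_obstruction_stable (a := a) (b := b) (m := m) (η := η) (E := E)
    (V := V) (H := K)
  refine Or.inr ⟨K, obstruction a b m η E V K n, hK, obstruction_subset n,
    fun w hw => hK.le_deg_of_mem_obstruction hw,
    ⟨v, obstruction_mono (Nat.zero_le n) (Finset.mem_filter.2 ⟨hv, hvη⟩), hvη⟩, ?_⟩
  intro e he heK ha hb
  have hred : ∀ w ∈ V, w ∉ obstruction a b m η E V K n →
      Reducible a b m η E V K (obstruction a b m η E V K n) w := by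
    intro w hw hwn
    by_contra hr
    rw [← hn] at hwn
    exact hwn (Finset.mem_filter.2 ⟨hw, hr⟩)
  exact hK.exists_tight_of_reducible hm hE
    (fun L hL => hmin L (Finset.mem_filter.2 ⟨Finset.mem_powerset.2 hL.subset, hL⟩)) he heK
    (hred _ (hE e he).1 ha) (hred _ (hE e he).2 hb)

/-- Counting the edges that meet `S` by the degrees in `S`. -/
lemma sum_deg_eq (hloop : ∀ e ∈ H, a e ≠ b e) (hE : ∀ e ∈ H, a e ∈ V ∧ b e ∈ V) (S : Finset α) :
    ∑ v ∈ S, deg a b H v + (inside a b H (V \ S)).card = H.card + (inside a b H S).card := by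
  have h1 : ∑ v ∈ S, deg a b H v = ∑ e ∈ H, (S.filter fun v => a e = v ∨ b e = v).card := by
    simp only [deg]
    exact Finset.sum_card_bipartiteAbove_eq_sum_card_bipartiteBelow _
  rw [h1, inside, inside, Finset.card_filter, Finset.card_filter, Finset.card_eq_sum_ones,
    ← Finset.sum_add_distrib, ← Finset.sum_add_distrib]
  -- For each edge, the number of its ends in `S`, plus 1 if there are none, equals 1, plus 1 if
  -- both ends are in `S`.
  refine Finset.sum_congr rfl fun e he => ?_
  have hne := hloop e he
  have h2 : (S.filter fun v => a e = v ∨ b e = v) =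
      (if a e ∈ S then {a e} else ∅) ∪ (if b e ∈ S then {b e} else ∅) := by
    rw [Finset.filter_or, Finset.filter_eq, Finset.filter_eq]
  rw [h2]
  by_cases ha : a e ∈ S <;> by_cases hb : b e ∈ S <;> simp [ha, hb, hE e he, hne]

/-- The degree sum formula. -/
lemma sum_deg_eq_two_mul (hloop : ∀ e ∈ H, a e ≠ b e) (hE : ∀ e ∈ H, a e ∈ V ∧ b e ∈ V) :
    ∑ v ∈ V, deg a b H v = 2 * H.card := by
  have h1 := sum_deg_eq hloop hE V
  have h2 : inside a b H V = H := Finset.filter_true_of_mem hE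
  rw [Finset.sdiff_self, h2, ← two_mul] at h1
  simpa [inside] using h1

end EdgeEnds

end

/-! ### From strong toughness to bounded degree. -/

section

open scoped Classical

namespace Graph

open EdgeEnds

variable {α β : Type*} {G K : Graph α β} {a b : β → α} {m : ℕ}

lemma HasEnds.edgeDegree_restrict_le (h : G.HasEnds a b) (F : Finset β) (v : α) :
    (G.restrict (F : Set β)).edgeDegree v ≤ deg a b F v := by
  rw [edgeDegree, deg, ← Set.ncard_coe_finset]
  refine Set.ncard_le_ncard ?_ (Finset.finite_toSet _)
  intro e he
  rw [mem_incidenceSet, restrict_inc] at he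
  obtain ⟨hi, heF⟩ := he
  have := hi.eq_or_eq_of_isLink (h e hi.edge_mem)
  simp only [Finset.coe_filter, Set.mem_ofPred_eq]
  exact ⟨heF, this.imp Eq.symm Eq.symm⟩

lemma HasEnds.edgeSet_deleteVerts (h : G.HasEnds a b) {V : Finset α} {E : Finset β}
    (hV : V(G) = V) (hE : E(G) = E) (S : Finset α) :
    E(G.deleteVerts (S : Set α)) = inside a b E (V \ S) := by
  rw [← h.edgeSet_induce hE (V \ S), deleteVerts, hV, Finset.coe_sdiff]

lemma IsSparseBasis.isBase {V : Finset α} {E I : Finset β} (h : IsSparseBasis m G a b V E I)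
    (hm : 1 ≤ m) (hV : V.Nonempty) (hΩ : Omega m G ≤ 1) : IsBase a b m E V I := by
  refine ⟨h.subset, h.sparse, ?_⟩
  have h1 := h.mul_Omega hm
  have h2 : (m : ℝ) * Omega m G ≤ m * 1 := by gcongr
  have h3 : (m * V.card : ℝ) ≤ I.card + m := by linarith
  have h4 : m * V.card ≤ I.card + m := by exact_mod_cast h3
  have h5 := h.sparse V hV
  rw [inside, Finset.filter_true_of_mem fun e he => h.mem_vertices (h.subset he)] at h5
  omega

/-- The tight sets in `ht` avoid `S` and so survive the deletion. This makes `mul_Omega` applicable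
to the smaller graph with the edges of `K`. -/
lemma IsSparseBasis.deleteVerts {V : Finset α} {E K : Finset β} (h : G.HasEnds a b)
    (hV : V(G) = V) (hE : E(G) = E) (hK : K ⊆ E) (hsp : Sparse a b m K) (S : Finset α)
    (ht : ∀ e ∈ E, e ∉ K → a e ∉ S → b e ∉ S →
        ∃ Z ⊆ V, Disjoint Z S ∧ Tight a b m K Z ∧ a e ∈ Z ∧ b e ∈ Z) :
    IsSparseBasis m (G.deleteVerts (S : Set α)) a b (V \ S) (inside a b E (V \ S))
      (inside a b K (V \ S)) := by
  refine ⟨h.of_le deleteVerts_le, ?_, h.edgeSet_deleteVerts hV hE S,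
    Finset.filter_subset_filter _ hK, hsp.mono inside_subset, ?_⟩
  · rw [vertexSet_deleteVerts, hV, Finset.coe_sdiff]
  · intro e he heK
    rw [mem_inside] at he heK
    have h1 := Finset.mem_sdiff.1 he.2.1
    have h2 := Finset.mem_sdiff.1 he.2.2
    obtain ⟨Z, hZV, hZS, hZ, haZ, hbZ⟩ := ht e he.1 (fun h => heK ⟨h, he.2⟩) h1.2 h2.2
    have hZ' : Z ⊆ V \ S := fun z hz =>
      Finset.mem_sdiff.2 ⟨hZV hz, Finset.disjoint_left.1 hZS hz⟩
    refine ⟨Z, hZ', ?_, haZ, hbZ⟩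
    have : inside a b (inside a b K (V \ S)) Z = inside a b K Z := by
      ext g
      simp only [mem_inside]
      exact ⟨fun h => ⟨h.1.1, h.2⟩, fun h => ⟨⟨h.1, hZ' h.2.1, hZ' h.2.2⟩, h.2⟩⟩
    rw [Tight, this]
    exact hZ

/-- A finite `m`-strongly `m`-tough graph has an `m`-tree-connected spanning subgraph with maximum
degree at most `2 m + 1`. -/
theorem IsStronglyTough.exists_isTreeConnected (hm : 1 ≤ m) (hloop : G.Loopless)
    (hVf : V(G).Finite) (hEf : E(G).Finite) (hne : V(G).Nonempty)
    (hG : IsStronglyTough m (m : ℝ) G) :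
    ∃ H : Graph α β, H ≤s G ∧ IsTreeConnected m H ∧
      ∀ v ∈ V(H), H.edgeDegree v ≤ 2 * m + 1 := by
  obtain ⟨a, b, h⟩ := exists_hasEnds hne
  obtain ⟨V, hV⟩ := hVf.exists_finset_coe
  obtain ⟨E, hE⟩ := hEf.exists_finset_coe
  obtain ⟨I, hI⟩ := exists_isSparseBasis m h hV.symm hE.symm
  have hVne : V.Nonempty := by rwa [← Finset.coe_nonempty, hV]
  have hΩ : Omega m G ≤ 1 := by simpa using hG ∅ (Set.empty_subset _)
  have hEV : ∀ e ∈ E, a e ∈ V ∧ b e ∈ V := fun e he => hI.mem_vertices he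
  have hne' : ∀ e ∈ E, a e ≠ b e := by
    intro e he hab
    have := h e (hE ▸ he)
    rw [hab] at this
    exact hloop.not_isLoopAt e _ this
  rcases (hI.isBase hm hVne hΩ).exists_deg_le_or_obstruction hm hEV (2 * m + 1) with
    ⟨K, hK, hdeg⟩ | ⟨K, S, hK, hSV, hdeg, ⟨v, hv, hvdeg⟩, ht⟩
  · refine ⟨G.restrict (K : Set β), ⟨restrict_le, rfl⟩, ?_, fun v hv => ?_⟩
    · obtain ⟨F, hF, hc⟩ := hK.sparse.exists_packing (fun e he => hEV e (hK.subset he))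
        hK.card_add.ge
      refine (h.of_le restrict_le).isTreeConnected (E := K) ?_ hne hF fun j x hx y hy => ?_
      · intro e he
        exact ⟨hE ▸ hK.subset he, he⟩
      · rw [vertexSet_restrict, ← hV] at hx hy
        exact hc j x hx y hy
    · rw [vertexSet_restrict, ← hV] at hv
      exact (h.edgeDegree_restrict_le K v).trans (hdeg v hv)
  · exfalso
    have hB := IsSparseBasis.deleteVerts h hV.symm hE.symm hK.subset hK.sparse S ht
    have h1 := hB.mul_Omega hm
    have h2 := hG S (by rw [← hV]; exact_mod_cast hSV)
    rw [Set.ncard_coe_finset] at h2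
    have hm' : (0 : ℝ) < m := by positivity
    have h3 : (m : ℝ) * Omega m (G.deleteVerts (S : Set α)) ≤ max (m : ℝ) (S.card : ℝ) := by
      refine (mul_le_mul_of_nonneg_left h2 hm'.le).trans ?_
      rw [mul_max_of_nonneg _ _ hm'.le, mul_one, ← mul_assoc, mul_one_div_cancel hm'.ne', one_mul]
    have h4 := sum_deg_eq (fun e he => hne' e (hK.subset he)) (fun e he => hEV e (hK.subset he)) S
    have h5 := hK.card_add
    have h6 := hK.sparse S ⟨v, hv⟩
    have h7 : (2 * m + 1) * S.card < ∑ v ∈ S, deg a b K v := by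
      calc (2 * m + 1) * S.card = ∑ _v ∈ S, (2 * m + 1) := by simp [mul_comm]
        _ < _ := Finset.sum_lt_sum hdeg ⟨v, hv, hvdeg⟩
    have h8 := Finset.card_sdiff_add_card_eq_card hSV
    have h9 : m * V.card = m * (V \ S).card + m * S.card := by rw [← h8]; ring
    -- Here |K| = m(|V| - 1), at most m(|S| - 1) edges of `K` are inside `S`, and the degrees in `S`
    -- sum to more than (2m + 1)|S|. Of 2m + 1, the summand 2m cancels the terms in |S| and the 1
    -- leaves the gain |S|.
    have h10 : (inside a b K (V \ S)).card + 2 * m + S.card < m * (V \ S).card := by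
      have : (2 * m + 1) * S.card = m * S.card + m * S.card + S.card := by ring
      omega
    have h11 : ((inside a b K (V \ S)).card : ℝ) + 2 * m + S.card < m * (V \ S).card := by
      exact_mod_cast h10
    rcases max_cases (m : ℝ) (S.card : ℝ) with ⟨hmax, -⟩ | ⟨hmax, -⟩
    · rw [hmax] at h3
      have : (0 : ℝ) ≤ S.card := by positivity
      linarith
    · rw [hmax] at h3
      linarith

end Graph

end

/-! ### Complete graphs: disjoint Hamiltonian paths. -/

section

open scoped Classical

namespace Graph

open EdgeEnds

variable {α β : Type*} {G : Graph α β} {m : ℕ}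

/-- A bijection between a nonempty finite set and the integers modulo its size. -/
lemma exists_zmod_labelling {V : Finset α} [NeZero V.card] :
    ∃ (f : α → ZMod V.card) (g : ZMod V.card → α),
      (∀ r, g r ∈ V) ∧ (∀ r, f (g r) = r) ∧ ∀ x ∈ V, g (f x) = x := by
  have hc : Fintype.card V = Fintype.card (ZMod V.card) := by
    rw [ZMod.card, Fintype.card_coe]
  let φ := Fintype.equivOfCardEq hc
  refine ⟨fun x => if hx : x ∈ V then φ ⟨x, hx⟩ else 0, fun r => (φ.symm r : α),
    fun r => (φ.symm r).2, fun r => ?_, fun x hx => ?_⟩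
  · simp
  · simp [hx]

/-- A choice of an edge for each pair of distinct vertices of a complete graph. -/
lemma exists_edge_choice {V : Finset α} (hV : V(G) = V) (hn : 2 ≤ V.card)
    (hG : ∀ x ∈ V(G), ∀ y ∈ V(G), x ≠ y → G.Adj x y) :
    ∃ c : Sym2 α → β, ∀ x ∈ V, ∀ y ∈ V, x ≠ y → G.IsLink (c s(x, y)) x y := by
  obtain ⟨x₀, hx₀, y₀, hy₀, hxy₀⟩ := Finset.one_lt_card.1 hn
  obtain ⟨e₀, -⟩ := hG x₀ (by rw [hV]; exact hx₀) y₀ (by rw [hV]; exact hy₀) hxy₀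
  have h : ∀ s : Sym2 α, ∃ e, ∀ x ∈ V, ∀ y ∈ V, x ≠ y → s = s(x, y) → G.IsLink e x y := by
    intro s
    induction s with
    | _ x y =>
      by_cases hxy : x ∈ V ∧ y ∈ V ∧ x ≠ y
      · obtain ⟨e, he⟩ := hG x (by rw [hV]; exact hxy.1) y (by rw [hV]; exact hxy.2.1) hxy.2.2
        refine ⟨e, fun u _ v _ _ hs => ?_⟩
        rcases Sym2.eq_iff.1 hs with ⟨rfl, rfl⟩ | ⟨rfl, rfl⟩
        · exact he
        · exact he.symm
      · refine ⟨e₀, fun u hu v hv huv hs => absurd ?_ hxy⟩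
        rcases Sym2.eq_iff.1 hs with ⟨rfl, rfl⟩ | ⟨rfl, rfl⟩
        · exact ⟨hu, hv, huv⟩
        · exact ⟨hv, hu, huv.symm⟩
  choose c hc using h
  exact ⟨c, fun x hx y hy hxy => hc _ x hx y hy hxy rfl⟩

/-- A complete graph with at least `2 m` vertices has an `m`-tree-connected spanning subgraph with
maximum degree at most `2 m`: with the vertices labelled by the integers modulo `n`, the pairs
with sum `2 i` or `2 i + 1` form a Hamiltonian path, and these paths are disjoint for `i < m`. -/
theorem exists_isTreeConnected_of_complete (hm : 1 ≤ m) (hVf : V(G).Finite) (hEf : E(G).Finite)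
    (hG : ∀ x ∈ V(G), ∀ y ∈ V(G), x ≠ y → G.Adj x y) (hn : 2 * m ≤ V(G).ncard) :
    ∃ H : Graph α β, H ≤s G ∧ IsTreeConnected m H ∧ ∀ v ∈ V(H), H.edgeDegree v ≤ 2 * m := by
  obtain ⟨V, hV⟩ := hVf.exists_finset_coe
  obtain ⟨E, hE⟩ := hEf.exists_finset_coe
  rw [← hV, Set.ncard_coe_finset] at hn
  have hne : V.Nonempty := Finset.card_pos.1 (by omega)
  obtain ⟨a, b, h⟩ := exists_hasEnds (G := G) (by rw [← hV]; exact_mod_cast hne)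
  have : NeZero V.card := ⟨by omega⟩
  obtain ⟨f, g, hgV, hfg, hgf⟩ := exists_zmod_labelling (V := V)
  obtain ⟨c, hc⟩ := exists_edge_choice hV.symm (by omega) hG
  -- Using one fixed edge per pair, also among parallel edges, leaves at most one edge at each
  -- vertex for each sum.
  let F : Fin m → Finset β := fun i => E.filter fun e => ∃ x ∈ V, ∃ y ∈ V, x ≠ y ∧ e = c s(x, y) ∧
    ∃ k : ℕ, (k = 2 * i.val ∨ k = 2 * i.val + 1) ∧ f x + f y = (k : ZMod V.card)
  have hcE : ∀ x ∈ V, ∀ y ∈ V, x ≠ y → c s(x, y) ∈ E := fun x hx y hy hxy => by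
    rw [← Finset.mem_coe, hE]; exact (hc x hx y hy hxy).edge_mem
  have hF : IsPacking (Finset.univ.biUnion F) F := by
    refine ⟨fun i => Finset.subset_biUnion_of_mem F (Finset.mem_univ i), fun i j hij => ?_⟩
    refine Finset.disjoint_left.2 fun e he he' => hij ?_
    obtain ⟨-, x, hx, y, hy, hxy, rfl, k, hk, hs⟩ := Finset.mem_filter.1 he
    obtain ⟨-, u, hu, v, hv, huv, heq, l, hl, ht⟩ := Finset.mem_filter.1 he'
    have h1 := hc x hx y hy hxy
    have h2 := hc u hu v hv huv
    rw [← heq] at h2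
    have hsum : f x + f y = f u + f v := by
      rcases h1.eq_and_eq_or_eq_and_eq h2 with ⟨rfl, rfl⟩ | ⟨rfl, rfl⟩
      · rfl
      · exact add_comm _ _
    have hkl : (k : ZMod V.card) = l := by rw [← hs, hsum, ht]
    -- All sums are below 2m ≤ |V|, so equal residues are equal numbers; this is where the lower
    -- bound on |V| enters.
    rw [ZMod.natCast_eq_natCast_iff, Nat.ModEq, Nat.mod_eq_of_lt, Nat.mod_eq_of_lt] at hkl
    all_goals have := i.2; have := j.2
    · apply Fin.ext; omega
    · omega
    · omega
  have hstep : ∀ (i : Fin m) (k : ℕ), (k = 2 * i.val ∨ k = 2 * i.val + 1) → ∀ r : ZMod V.card,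
      Conn a b (F i : Set β) (g r) (g (k - r)) := by
    intro i k hk r
    -- A label that is fixed by the reflection gives no pair, and no edge is needed.
    by_cases hxy : g r = g (k - r)
    · rw [← hxy]; exact Conn.refl _ _
    · have h1 := hc _ (hgV r) _ (hgV (k - r)) hxy
      have h2 : c s(g r, g (k - r)) ∈ F i := Finset.mem_filter.2 ⟨hcE _ (hgV r) _ (hgV _) hxy,
        _, hgV r, _, hgV _, hxy, rfl, k, hk, by rw [hfg, hfg]; ring⟩
      have h3 := Conn.edge (a := a) (b := b) (F := (F i : Set β)) h2
      rcases (h _ h1.edge_mem).eq_and_eq_or_eq_and_eq h1 with ⟨h4, h5⟩ | ⟨h4, h5⟩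
      · rwa [h4, h5] at h3
      · rw [h4, h5] at h3; exact h3.symm
  have hconn : ∀ (i : Fin m) (r : ℕ), Conn a b (F i : Set β) (g 0) (g (r : ZMod V.card)) := by
    intro i r
    induction r with
    | zero => rw [Nat.cast_zero]; exact Conn.refl _ _
    | succ r ih =>
      -- The reflections with sums 2i and 2i + 1 compose to the shift from r to r + 1.
      refine ih.trans ((hstep i _ (Or.inl rfl) r).trans ?_)
      have h1 := hstep i _ (Or.inr rfl) (((2 * i.val : ℕ) : ZMod V.card) - r)
      have h2 : (((2 * i.val + 1 : ℕ) : ZMod V.card) - (((2 * i.val : ℕ) : ZMod V.card) - r)) =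
          ((r + 1 : ℕ) : ZMod V.card) := by
        push_cast; ring
      rwa [h2] at h1
  have hconn' : ∀ i, ∀ x ∈ V, Conn a b (F i : Set β) (g 0) x := by
    intro i x hx
    have := hconn i (f x).val
    rwa [ZMod.natCast_zmod_val, hgf x hx] at this
  refine ⟨G.restrict (Finset.univ.biUnion F : Finset β), ⟨restrict_le, rfl⟩, ?_, ?_⟩
  · refine (h.of_le restrict_le).isTreeConnected (E := Finset.univ.biUnion F) ?_ ?_ hF ?_
    · intro e he
      refine ⟨?_, he⟩
      obtain ⟨i, -, hi⟩ := Finset.mem_biUnion.1 he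
      rw [← hE]
      exact (Finset.mem_filter.1 hi).1
    · rw [vertexSet_restrict, ← hV]; exact_mod_cast hne
    · intro j x hx y hy
      rw [vertexSet_restrict, ← hV] at hx hy
      exact (hconn' j x hx).symm.trans (hconn' j y hy)
  · intro v _
    have hsub : (G.restrict (Finset.univ.biUnion F : Finset β)).incidenceSet v ⊆
        (((Finset.range (2 * m)).image fun k : ℕ => c s(v, g ((k : ZMod V.card) - f v)) :
          Finset β) : Set β) := by
      intro e he
      rw [mem_incidenceSet, restrict_inc] at he
      obtain ⟨hinc, he⟩ := he
      obtain ⟨i, -, hi⟩ := Finset.mem_biUnion.1 he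
      obtain ⟨-, x, hx, y, hy, hxy, rfl, k, hk, hs⟩ := Finset.mem_filter.1 hi
      have hkm : k ∈ Finset.range (2 * m) := by
        have := i.2
        rw [Finset.mem_range]
        omega
      refine Finset.mem_coe.2 (Finset.mem_image.2 ⟨k, hkm, ?_⟩)
      rcases hinc.eq_or_eq_of_isLink (hc x hx y hy hxy) with rfl | rfl
      · rw [← hs, add_sub_cancel_left, hgf y hy]
      · rw [← hs, add_sub_cancel_right, hgf x hx, Sym2.eq_swap]
    rw [edgeDegree]
    refine (Set.ncard_le_ncard hsub (Finset.finite_toSet _)).trans ?_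
    rw [Set.ncard_coe_finset]
    exact Finset.card_image_le.trans (by simp)

end Graph

end

/-! ### Independent families of parts, and separation in tough graphs. -/

section

open scoped Classical

/-- A weighted form of the Caro-Wei bound: for a reflexive and symmetric relation `r`, there is an
independent set of weight at least `∑ g`, if `g u` is at most the weight of `u` divided by the
size of its closed neighbourhood. -/
lemma Finset.exists_independent_sum_le {ι : Type*} (r : ι → ι → Prop) (hrefl : ∀ u, r u u)
    (hsymm : ∀ u v, r u v → r v u) (w g : ι → ℝ) (s : Finset ι) (hg : ∀ u ∈ s, 0 ≤ g u)
    (h : ∀ u ∈ s, g u * ((s.filter fun v => r u v).card : ℝ) ≤ w u) :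
    ∃ J ⊆ s, (∀ u ∈ J, ∀ v ∈ J, u ≠ v → ¬ r u v) ∧ ∑ u ∈ s, g u ≤ ∑ u ∈ J, w u := by
  induction s using Finset.strongInduction with
  | H s ih =>
    rcases s.eq_empty_or_nonempty with rfl | hs
    · exact ⟨∅, by simp⟩
    -- By averaging, the weight of some `v` is at least the sum of `g` over its closed
    -- neighbourhood. Select `v`, discard that neighbourhood and use induction.
    have hsum : ∑ v ∈ s, ∑ u ∈ s.filter (fun u => r u v), g u ≤ ∑ v ∈ s, w v := by
      calc ∑ v ∈ s, ∑ u ∈ s.filter (fun u => r u v), g u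
          = ∑ u ∈ s, ∑ v ∈ s.filter (fun v => r u v), g u := by
            simp only [Finset.sum_filter]
            exact Finset.sum_comm
        _ = ∑ u ∈ s, g u * ((s.filter fun v => r u v).card : ℝ) := by
            simp [mul_comm]
        _ ≤ _ := Finset.sum_le_sum h
    obtain ⟨v, hv, hvw⟩ := Finset.exists_le_of_sum_le hs hsum
    have hss : (s.filter fun u => ¬ r u v) ⊂ s :=
      Finset.filter_ssubset.2 ⟨v, hv, not_not.2 (hrefl v)⟩
    obtain ⟨J, hJ, hind, hle⟩ := ih _ hss (fun u hu => hg u (hss.1 hu)) fun u hu => by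
      refine le_trans (mul_le_mul_of_nonneg_left ?_ (hg u (hss.1 hu))) (h u (hss.1 hu))
      exact_mod_cast Finset.card_le_card (Finset.filter_subset_filter _ hss.1)
    have hJr : ∀ u ∈ J, ¬ r u v := fun u hu => (Finset.mem_filter.1 (hJ hu)).2
    have hvJ : v ∉ J := fun hvJ => hJr v hvJ (hrefl v)
    refine ⟨insert v J, Finset.insert_subset hv (hJ.trans hss.1), ?_, ?_⟩
    · intro x hx y hy hxy
      rcases Finset.mem_insert.1 hx with rfl | hx' <;> rcases Finset.mem_insert.1 hy with rfl | hy'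
      · exact absurd rfl hxy
      · exact fun hr => hJr y hy' (hsymm _ _ hr)
      · exact hJr x hx'
      · exact hind x hx' y hy' hxy
    · rw [Finset.sum_insert hvJ, ← Finset.sum_filter_add_sum_filter_not s fun u => r u v]
      exact add_le_add hvw hle

namespace EdgeEnds

variable {α β : Type*} {a b : β → α} {m : ℕ} {I E : Finset β} {V : Finset α}

/-- Maximal `1`-tight sets are not joined by edges of the sparse set. -/
lemma Sparse.part_eq_of_one (hI : Sparse a b 1 I) {e : β} (he : e ∈ I) (ha : a e ∈ V)
    (hb : b e ∈ V) : part a b 1 I V (a e) = part a b 1 I V (b e) := by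
  by_contra hne
  obtain ⟨hA, haA, hAV⟩ := hI.part_spec ha
  obtain ⟨hB, hbB, hBV⟩ := hI.part_spec hb
  have hd := hI.parts_disjoint (mem_parts.2 ⟨_, ha, rfl⟩) (mem_parts.2 ⟨_, hb, rfl⟩) hne
  set A := part a b 1 I V (a e)
  set B := part a b 1 I V (b e)
  have haB : a e ∉ B := Finset.disjoint_left.1 hd haA
  have hbA : b e ∉ A := Finset.disjoint_right.1 hd hbB
  have hdi : Disjoint (inside a b I A) (inside a b I B) := Finset.disjoint_left.2 fun f hf hf' =>
    Finset.disjoint_left.1 hd (mem_inside.1 hf).2.1 (mem_inside.1 hf').2.1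
  have he' : e ∉ inside a b I A ∪ inside a b I B := by
    simp [mem_inside, haB, hbA]
  have h1 : insert e (inside a b I A ∪ inside a b I B) ⊆ inside a b I (A ∪ B) := by
    refine Finset.insert_subset (mem_inside.2 ⟨he, ?_, ?_⟩) (Finset.union_subset
      (inside_mono Finset.subset_union_left) (inside_mono Finset.subset_union_right))
    · exact Finset.mem_union_left _ haA
    · exact Finset.mem_union_right _ hbB
  have h2 := Finset.card_le_card h1
  rw [Finset.card_insert_of_notMem he', Finset.card_union_of_disjoint hdi] at h2
  have hn : (A ∪ B).Nonempty := ⟨_, Finset.mem_union_left _ haA⟩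
  have h3 := hI _ hn
  have h4 := hA.2
  have h5 := hB.2
  have h6 := Finset.card_union_of_disjoint hd
  have ht : Tight a b 1 I (A ∪ B) := ⟨hn, by omega⟩
  exact hbA (ht.subset_part (Finset.union_subset hAV hBV) (Finset.mem_union_left _ haA)
    (Finset.mem_union_right _ hbB))

variable (a b) in
/-- The edges of `E` between the part `A` and other parts. -/
noncomputable def boundary (m : ℕ) (I : Finset β) (V : Finset α) (E : Finset β) (A : Finset α) :
    Finset β :=
  (E.filter fun e => part a b m I V (a e) ≠ part a b m I V (b e)).filter fun e =>
    part a b m I V (a e) = A ∨ part a b m I V (b e) = A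

variable (a b) in
/-- The ends outside the part `A` of the edges that leave `A`. -/
noncomputable def outerEnds (m : ℕ) (I : Finset β) (V : Finset α) (E : Finset β) (A : Finset α) :
    Finset α :=
  (boundary a b m I V E A).image fun e => if part a b m I V (a e) = A then b e else a e

variable (a b) in
/-- The ends in the part `A` of the edges that leave `A`. -/
noncomputable def innerEnds (m : ℕ) (I : Finset β) (V : Finset α) (E : Finset β) (A : Finset α) :
    Finset α :=
  (boundary a b m I V E A).image fun e => if part a b m I V (a e) = A then a e else b e

lemma card_outerEnds_le (A : Finset α) :
    (outerEnds a b m I V E A).card ≤ (boundary a b m I V E A).card :=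
  Finset.card_image_le

lemma card_innerEnds_le (A : Finset α) :
    (innerEnds a b m I V E A).card ≤ (boundary a b m I V E A).card :=
  Finset.card_image_le

variable (a b) in
/-- Two parts are equal or joined by an edge of `E`. -/
def PartRel (m : ℕ) (I : Finset β) (V : Finset α) (E : Finset β) (A B : Finset α) : Prop :=
  A = B ∨ ∃ e ∈ E, part a b m I V (a e) ≠ part a b m I V (b e) ∧
    ((part a b m I V (a e) = A ∧ part a b m I V (b e) = B) ∨
      (part a b m I V (a e) = B ∧ part a b m I V (b e) = A))

lemma PartRel.symm {A B : Finset α} (h : PartRel a b m I V E A B) : PartRel a b m I V E B A := by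
  rcases h with h | ⟨e, he, hne, h⟩
  · exact Or.inl h.symm
  · exact Or.inr ⟨e, he, hne, h.symm⟩

lemma card_filter_partRel_le (s : Finset (Finset α)) (A : Finset α) :
    (s.filter fun B => PartRel a b m I V E A B).card ≤ (boundary a b m I V E A).card + 1 := by
  have h : (s.filter fun B => PartRel a b m I V E A B) ⊆
      insert A ((boundary a b m I V E A).image fun e =>
        if part a b m I V (a e) = A then part a b m I V (b e) else part a b m I V (a e)) := by
    intro B hB
    rcases (Finset.mem_filter.1 hB).2 with rfl | ⟨e, he, hne, h⟩
    · exact Finset.mem_insert_self _ _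
    · refine Finset.mem_insert_of_mem (Finset.mem_image.2 ⟨e, ?_, ?_⟩)
      · refine Finset.mem_filter.2 ⟨Finset.mem_filter.2 ⟨he, hne⟩, ?_⟩
        exact h.imp And.left And.right
      · rcases h with ⟨h1, h2⟩ | ⟨h1, h2⟩
        · rw [if_pos h1, h2]
        · rw [if_neg (fun h3 => hne (h3.trans h2.symm)), h1]
  refine (Finset.card_le_card h).trans ((Finset.card_insert_le _ _).trans ?_)
  gcongr
  exact Finset.card_image_le

end EdgeEnds

/-- The claim amounts to 0 ≤ d² - (2m + 1)d + 2m² - 2. The discriminant is negative for m ≥ 3. For m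
= 2 the quadratic is (d - 2)(d - 3), nonnegative at integers. For m = 1 it is d(d - 3), negative at
1 and 2; hence the extra hypothesis, supplied by `Sparse.part_eq_of_one`. -/
lemma sub_half_mul_le {m d : ℕ} (hm : 1 ≤ m) (h : m = 1 → d = 0) :
    ((m : ℝ) - d / 2) * (d + 1) ≤ (m : ℝ) ^ 2 + m - 1 - d := by
  have key : (0 : ℤ) ≤ (d : ℤ) ^ 2 - (2 * m + 1) * d + 2 * (m : ℤ) ^ 2 - 2 := by
    rcases Nat.lt_or_ge m 3 with hlt | hge
    · interval_cases m
      · simp [h rfl]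
      · rcases Nat.lt_or_ge d 3 with h1 | h1
        · interval_cases d <;> norm_num
        · obtain ⟨k, rfl⟩ := Nat.exists_eq_add_of_le h1
          push_cast
          nlinarith [sq_nonneg (k : ℤ)]
    · zify at hge
      nlinarith [sq_nonneg (2 * (d : ℤ) - (2 * m + 1))]
  have key' : (0 : ℝ) ≤ (d : ℝ) ^ 2 - (2 * m + 1) * d + 2 * (m : ℝ) ^ 2 - 2 := by exact_mod_cast key
  nlinarith

namespace Graph

open EdgeEnds

variable {α β : Type*} {G : Graph α β} {a b : β → α} {m : ℕ} {t : ℝ} {V W : Finset α}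
  {E I : Finset β}

lemma Reachable.mem_of_closed {X : Set α} (hX : ∀ x ∈ X, ∀ y, G.Adj x y → y ∈ X) {x y : α}
    (h : G.Reachable x y) (hx : x ∈ X) : y ∈ X := by
  induction h with
  | refl => exact hx
  | tail _ h2 ih => exact hX _ ih _ h2

/-- Toughness bounds the number of disjoint vertex sets that are separated by `T`. -/
lemma IsTough.mul_card_le (hG : IsTough t G) (ht : 0 < t) (hV : V(G) = V) {T : Finset α}
    (hT : T ⊆ V) (J : Finset (Finset α)) (hJ : 2 ≤ J.card)
    (hne : ∀ A ∈ J, A.Nonempty) (hsub : ∀ A ∈ J, A ⊆ V \ T)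
    (hdisj : ∀ A ∈ J, ∀ B ∈ J, A ≠ B → Disjoint A B)
    (hclosed : ∀ A ∈ J, ∀ x ∈ A, ∀ y ∈ V \ T, G.Adj x y → y ∈ A) :
    t * J.card ≤ T.card := by
  have hcl : ∀ A ∈ J, ∀ x ∈ (A : Set α), ∀ y, (G.deleteVerts (T : Set α)).Adj x y →
      y ∈ (A : Set α) := by
    rintro A hA x hx y ⟨e, he⟩
    have hy := he.right_mem
    rw [vertexSet_deleteVerts, hV, ← Finset.coe_sdiff] at hy
    exact hclosed A hA x hx y hy ⟨e, he.mono deleteVerts_le⟩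
  have h1 : J.card ≤ (G.deleteVerts (T : Set α)).numComponents := by
    obtain ⟨A₀, hA₀⟩ := Finset.card_pos.1 (by omega : 0 < J.card)
    have : Nonempty α := ⟨(hne A₀ hA₀).choose⟩
    choose! p hp using hne
    have hpV : ∀ A ∈ J, p A ∈ V(G.deleteVerts (T : Set α)) := fun A hA => by
      rw [vertexSet_deleteVerts, hV, ← Finset.coe_sdiff]
      exact hsub A hA (hp A hA)
    let C : Finset α → Set α := fun A =>
      {y | y ∈ V(G.deleteVerts (T : Set α)) ∧ (G.deleteVerts (T : Set α)).Reachable (p A) y}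
    rw [numComponents, ← Set.ncard_coe_finset]
    refine Set.ncard_le_ncard_of_injOn C (fun A hA => ⟨p A, hpV A hA, rfl⟩) ?_ ?_
    · intro A hA B hB hAB
      by_contra hne
      have h2 : p A ∈ C B := by
        rw [← hAB]; exact ⟨hpV A hA, Relation.ReflTransGen.refl⟩
      have h3 : p A ∈ (B : Set α) := h2.2.mem_of_closed (hcl B hB) (hp B hB)
      exact Finset.disjoint_left.1 (hdisj A hA B hB hne) (hp A hA) h3
    · refine Set.Finite.subset (Set.Finite.finite_subsets V.finite_toSet) ?_
      rintro _ ⟨x, -, rfl⟩ y hy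
      have := hy.1
      rw [vertexSet_deleteVerts, hV] at this
      exact this.1
  have h2 := hG T (by rw [hV]; exact_mod_cast hT)
  rw [Set.ncard_coe_finset] at h2
  have h3 : (2 : ℝ) ≤ J.card := by exact_mod_cast hJ
  have h4 : (J.card : ℝ) ≤ (G.deleteVerts (T : Set α)).numComponents := by exact_mod_cast h1
  -- At least two components exclude the value 1 of the maximum.
  rcases le_max_iff.1 (h4.trans h2) with h5 | h5
  · linarith
  · rw [one_div, inv_mul_eq_div, le_div_iff₀ ht] at h5
    linarith

/-- Toughness for two separated vertex sets. -/
lemma IsTough.two_mul_le (hG : IsTough t G) (ht : 0 < t) (hV : V(G) = V) {T : Finset α}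
    (hT : T ⊆ V) {A B : Finset α} (hA : A.Nonempty) (hB : B.Nonempty) (hAT : A ⊆ V \ T)
    (hBT : B ⊆ V \ T) (hAB : Disjoint A B)
    (hAcl : ∀ x ∈ A, ∀ y ∈ V \ T, G.Adj x y → y ∈ A)
    (hBcl : ∀ x ∈ B, ∀ y ∈ V \ T, G.Adj x y → y ∈ B) : 2 * t ≤ T.card := by
  have hne : A ≠ B := by
    rintro rfl
    exact hA.ne_empty (disjoint_self.1 hAB)
  have hc : ({A, B} : Finset (Finset α)).card = 2 := Finset.card_pair hne
  have := hG.mul_card_le ht hV hT {A, B} hc.ge (by simp [hA, hB]) (by simp [hAT, hBT]) ?_ ?_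
  · rw [hc] at this
    push_cast at this
    linarith
  · intro X hX Y hY hXY
    simp only [Finset.mem_insert, Finset.mem_singleton] at hX hY
    rcases hX with rfl | rfl <;> rcases hY with rfl | rfl
    · exact absurd rfl hXY
    · exact hAB
    · exact hAB.symm
    · exact absurd rfl hXY
  · intro X hX
    simp only [Finset.mem_insert, Finset.mem_singleton] at hX
    rcases hX with rfl | rfl <;> assumption

/-- A tough graph in which two vertices are not adjacent has many vertices. -/
lemma IsTough.two_mul_add_two_le (hG : IsTough t G) (ht : 0 < t) (hV : V(G) = V) {x y : α}
    (hx : x ∈ V) (hy : y ∈ V) (hxy : x ≠ y) (hadj : ¬ G.Adj x y) : 2 * t + 2 ≤ V.card := by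
  have hp : ({x, y} : Finset α) ⊆ V := by
    intro z hz
    simp only [Finset.mem_insert, Finset.mem_singleton] at hz
    rcases hz with rfl | rfl <;> assumption
  have hVT : V \ (V \ {x, y}) = {x, y} := Finset.sdiff_sdiff_eq_self hp
  have h1 := hG.two_mul_le ht hV (T := V \ {x, y}) Finset.sdiff_subset (A := {x}) (B := {y})
    (by simp) (by simp) (by rw [hVT]; simp) (by rw [hVT]; simp) (by simpa using hxy)
    (by
      rw [hVT]
      simp only [Finset.mem_singleton, Finset.mem_insert]
      rintro _ rfl z (rfl | rfl) h
      · rfl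
      · exact absurd h hadj)
    (by
      rw [hVT]
      simp only [Finset.mem_singleton, Finset.mem_insert]
      rintro _ rfl z (rfl | rfl) h
      · exact absurd h.symm hadj
      · rfl)
  have h2 := Finset.card_sdiff_add_card_eq_card hp
  rw [Finset.card_pair hxy] at h2
  have h3 : ((V \ {x, y}).card : ℝ) + 2 = V.card := by exact_mod_cast h2
  linarith

namespace IsSparseBasis

lemma mem_boundary (h : IsSparseBasis m G a b W E I) {A : Finset α}
    (hA : A ∈ parts a b m I W) {x y : α} {e : β} (he : G.IsLink e x y) (hx : x ∈ A) (hy : y ∉ A) :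
    e ∈ boundary a b m I W E A ∧ y ∈ outerEnds a b m I W E A ∧ x ∈ innerEnds a b m I W E A := by
  have heE : e ∈ E := by rw [← Finset.mem_coe, ← h.edgeSet_eq]; exact he.edge_mem
  have hyW : y ∈ W := by rw [← Finset.mem_coe, ← h.vertexSet_eq]; exact he.right_mem
  have hpx : part a b m I W x = A := h.sparse.part_eq_of_mem_parts hA hx
  have hpy : part a b m I W y ≠ A := fun h' => hy (h' ▸ (h.sparse.part_spec hyW).2.1)
  rcases (h.hasEnds e he.edge_mem).eq_and_eq_or_eq_and_eq he with ⟨h1, h2⟩ | ⟨h1, h2⟩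
  · have hb : e ∈ boundary a b m I W E A := Finset.mem_filter.2
      ⟨Finset.mem_filter.2 ⟨heE, by rw [h1, h2, hpx]; exact hpy.symm⟩, Or.inl (by rw [h1, hpx])⟩
    have hp : part a b m I W (a e) = A := by rw [h1, hpx]
    exact ⟨hb, Finset.mem_image.2 ⟨e, hb, by rw [if_pos hp, h2]⟩,
      Finset.mem_image.2 ⟨e, hb, by rw [if_pos hp, h1]⟩⟩
  · have hb : e ∈ boundary a b m I W E A := Finset.mem_filter.2
      ⟨Finset.mem_filter.2 ⟨heE, by rw [h1, h2, hpx]; exact hpy⟩, Or.inr (by rw [h2, hpx])⟩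
    have hp : ¬ part a b m I W (a e) = A := by rw [h1]; exact hpy
    exact ⟨hb, Finset.mem_image.2 ⟨e, hb, by rw [if_neg hp, h1]⟩,
      Finset.mem_image.2 ⟨e, hb, by rw [if_neg hp, h2]⟩⟩

lemma mem_outerEnds (h : IsSparseBasis m G a b W E I) {A : Finset α} {y : α}
    (hy : y ∈ outerEnds a b m I W E A) : y ∈ W ∧ part a b m I W y ≠ A ∧
      PartRel a b m I W E A (part a b m I W y) := by
  obtain ⟨e, he, rfl⟩ := Finset.mem_image.1 hy
  obtain ⟨h1, h2⟩ := Finset.mem_filter.1 he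
  obtain ⟨h3, h4⟩ := Finset.mem_filter.1 h1
  obtain ⟨ha, hb⟩ := h.mem_vertices h3
  split_ifs with hp
  · exact ⟨hb, fun h5 => h4 (hp.trans h5.symm), Or.inr ⟨e, h3, h4, Or.inl ⟨hp, rfl⟩⟩⟩
  · exact ⟨ha, hp, Or.inr ⟨e, h3, h4, Or.inr ⟨rfl, h2.resolve_left hp⟩⟩⟩

/-- This is the degree sum formula in the graph obtained by contracting every part. -/
lemma sum_card_boundary (h : IsSparseBasis m G a b W E I) :
    ∑ A ∈ parts a b m I W, (boundary a b m I W E A).card =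
      2 * (E.filter fun e => part a b m I W (a e) ≠ part a b m I W (b e)).card := by
  set C := E.filter fun e => part a b m I W (a e) ≠ part a b m I W (b e) with hC
  have hP : ∀ e ∈ C, (part a b m I W ∘ a) e ∈ parts a b m I W ∧
      (part a b m I W ∘ b) e ∈ parts a b m I W := fun e he => by
    obtain ⟨ha, hb⟩ := h.mem_vertices (Finset.mem_filter.1 he).1
    exact ⟨mem_parts.2 ⟨_, ha, rfl⟩, mem_parts.2 ⟨_, hb, rfl⟩⟩
  rw [← sum_deg_eq_two_mul (a := part a b m I W ∘ a) (b := part a b m I W ∘ b) (H := C)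
    (fun e he => (Finset.mem_filter.1 he).2) hP]
  exact Finset.sum_congr rfl fun A _ => by
    unfold deg boundary
    congr!

/-- There is a set of pairwise nonadjacent parts with few boundary edges. -/
lemma exists_independent (h : IsSparseBasis m G a b W E I) (hm : 1 ≤ m) :
    ∃ J ⊆ parts a b m I W, (∀ A ∈ J, ∀ B ∈ J, A ≠ B → ¬ PartRel a b m I W E A B) ∧
      (m : ℝ) * (parts a b m I W).card -
        (E.filter fun e => part a b m I W (a e) ≠ part a b m I W (b e)).card ≤
      ∑ A ∈ J, ((m : ℝ) ^ 2 + m - 1 - (boundary a b m I W E A).card) := by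
  have hone : ∀ A, m = 1 → (boundary a b m I W E A).card = 0 := by
    rintro A rfl
    rw [Finset.card_eq_zero, Finset.eq_empty_iff_forall_notMem]
    intro e he
    have h1 := (Finset.mem_filter.1 he).1
    rw [h.filter_part_eq] at h1
    obtain ⟨h2, h3⟩ := Finset.mem_filter.1 h1
    obtain ⟨ha, hb⟩ := h.mem_vertices (h.subset h2)
    exact h3 (h.sparse.part_eq_of_one h2 ha hb)
  let d : Finset α → ℝ := fun A => ((boundary a b m I W E A).card : ℝ)
  -- The restriction makes m - d/2 nonnegative, as the Caro-Wei bound requires; the omitted parts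
  -- contribute negative terms only.
  let s := (parts a b m I W).filter fun A => d A ≤ 2 * m
  obtain ⟨J, hJ, hind, hle⟩ := Finset.exists_independent_sum_le (PartRel a b m I W E)
    (fun _ => Or.inl rfl) (fun _ _ h => h.symm) (fun A => (m : ℝ) ^ 2 + m - 1 - d A)
    (fun A => m - d A / 2) s
    (fun A hA => by have := (Finset.mem_filter.1 hA).2; linarith)
    (fun A hA => by
      have h1 := (Finset.mem_filter.1 hA).2
      refine le_trans (mul_le_mul_of_nonneg_left ?_ (by linarith)) (sub_half_mul_le hm (hone A))
      have h2 := card_filter_partRel_le (a := a) (b := b) (m := m) (I := I) (V := W) (E := E) s A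
      exact_mod_cast h2)
  refine ⟨J, hJ.trans (Finset.filter_subset _ _), hind, le_trans ?_ hle⟩
  have h2 : ∑ A ∈ parts a b m I W, ((m : ℝ) - d A / 2) = m * (parts a b m I W).card -
      (E.filter fun e => part a b m I W (a e) ≠ part a b m I W (b e)).card := by
    have h3 : ∑ A ∈ parts a b m I W, d A =
        2 * (E.filter fun e => part a b m I W (a e) ≠ part a b m I W (b e)).card := by
      have h4 := congrArg (Nat.cast : ℕ → ℝ) h.sum_card_boundary
      push_cast at h4
      exact h4
    rw [Finset.sum_sub_distrib, ← Finset.sum_div, h3]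
    simp only [Finset.sum_const, nsmul_eq_mul]
    ring
  rw [← h2, ← Finset.sum_filter_add_sum_filter_not (parts a b m I W) fun A => d A ≤ 2 * m]
  have h4 : ∑ A ∈ (parts a b m I W).filter (fun A => ¬ d A ≤ 2 * m), ((m : ℝ) - d A / 2) ≤ 0 :=
    Finset.sum_nonpos fun A hA => by
      have := (Finset.mem_filter.1 hA).2
      push Not at this
      linarith
  linarith

end IsSparseBasis

end Graph

end

/-! ### Strong toughness of tough graphs. -/

section

open scoped Classical

namespace Graph

open EdgeEnds

variable {α β : Type*} {G : Graph α β} {a b : β → α} {m : ℕ} {V S : Finset α} {E I : Finset β}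

namespace IsSparseBasis

lemma mem_ends_of_adj
    (h : IsSparseBasis m (G.deleteVerts (S : Set α)) a b (V \ S) E I) {A : Finset α}
    (hA : A ∈ parts a b m I (V \ S)) {x y : α} (hx : x ∈ A) (hy : y ∈ V \ S) (hyA : y ∉ A)
    (hadj : G.Adj x y) :
    y ∈ outerEnds a b m I (V \ S) E A ∧ x ∈ innerEnds a b m I (V \ S) E A := by
  obtain ⟨e, he⟩ := hadj
  have hxS := (Finset.mem_sdiff.1 ((h.sparse.parts_spec hA).2 hx)).2
  exact (h.mem_boundary hA (e := e) (x := x) (y := y)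
    ((deleteVerts_isLink _ _).2 ⟨he, hxS, (Finset.mem_sdiff.1 hy).2⟩) hx hyA).2

/-- The bound for strong toughness, if not too few vertices are present. -/
lemma le_card_of_tough (hm : 1 ≤ m) (hG : IsTough ((m : ℝ) ^ 2 + m - 1) G) (hV : V(G) = V)
    (hS : S ⊆ V) (hcard : 2 * ((m : ℝ) ^ 2 + m - 1) + 2 ≤ V.card)
    (h : IsSparseBasis m (G.deleteVerts (S : Set α)) a b (V \ S) E I)
    (hP : 2 ≤ (parts a b m I (V \ S)).card) :
    (m : ℝ) * (parts a b m I (V \ S)).card -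
      (E.filter fun e => part a b m I (V \ S) (a e) ≠ part a b m I (V \ S) (b e)).card ≤
      S.card := by
  by_contra! hlt
  obtain ⟨J, hJP, hind, hle⟩ := h.exists_independent hm
  have hm' : (1 : ℝ) ≤ m := by exact_mod_cast hm
  have ht : (0 : ℝ) < (m : ℝ) ^ 2 + m - 1 := by nlinarith
  set t : ℝ := (m : ℝ) ^ 2 + m - 1 with htdef
  set d : Finset α → ℕ := fun A => (boundary a b m I (V \ S) E A).card with hd
  have hJsum : (S.card : ℝ) < ∑ A ∈ J, (t - d A) := hlt.trans_le hle
  have hne : ∀ A ∈ parts a b m I (V \ S), A.Nonempty := fun A hA => (h.sparse.parts_spec hA).1.1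
  have hsub : ∀ A ∈ parts a b m I (V \ S), A ⊆ V \ S := fun A hA => (h.sparse.parts_spec hA).2
  have hout : ∀ A, outerEnds a b m I (V \ S) E A ⊆ V := fun A y hy =>
    (Finset.mem_sdiff.1 (h.mem_outerEnds hy).1).1
  have hoA : ∀ A ∈ parts a b m I (V \ S), ∀ x ∈ A, x ∉ outerEnds a b m I (V \ S) E A :=
    fun A hA x hx hxo => (h.mem_outerEnds hxo).2.1 (h.sparse.part_eq_of_mem_parts hA hx)
  -- If J = {A}, then |S| + d(A) < t. Deleting `S` with the outer ends, or with the inner ends,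
  -- removes too few vertices to separate the graph. So all of the rest consists of outer ends and
  -- all of `A` of inner ends, whence |V| ≤ |S| + 2d(A) < 2t.
  rcases Nat.lt_or_ge J.card 2 with hJ1 | hJ2
  · have hJne : J.Nonempty := by
      rw [Finset.nonempty_iff_ne_empty]
      rintro rfl
      simp only [Finset.sum_empty] at hJsum
      have : (0 : ℝ) ≤ S.card := by positivity
      linarith
    obtain ⟨A, rfl⟩ := Finset.card_eq_one.1
      (by have := hJne.card_pos; omega : J.card = 1)
    rw [Finset.sum_singleton] at hJsum
    have hA : A ∈ parts a b m I (V \ S) := hJP (Finset.mem_singleton_self A)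
    have hAW := hsub A hA
    have hS0 : (0 : ℝ) ≤ S.card := by positivity
    have hrest : ((V \ S) \ A).Nonempty := by
      obtain ⟨B, hB, hBA⟩ := Finset.exists_mem_ne (by omega : 1 < (parts a b m I (V \ S)).card) A
      obtain ⟨x, hx⟩ := hne B hB
      exact ⟨x, Finset.mem_sdiff.2 ⟨hsub B hB hx,
        Finset.disjoint_left.1 (h.sparse.parts_disjoint hB hA hBA) hx⟩⟩
    have hcardle : ∀ O : Finset α, O.card ≤ d A → ((S ∪ O).card : ℝ) < t := by
      intro O hO
      have h1 : (S ∪ O).card ≤ S.card + d A := (Finset.card_union_le _ _).trans (by omega)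
      have h2 : ((S ∪ O).card : ℝ) ≤ S.card + d A := by exact_mod_cast h1
      linarith
    have hVS : ∀ {O : Finset α} {y : α}, y ∈ V \ (S ∪ O) → y ∈ V \ S ∧ y ∉ O := by
      intro O y hy
      simp only [Finset.mem_sdiff, Finset.mem_union, not_or] at hy ⊢
      exact ⟨⟨hy.1, hy.2.1⟩, hy.2.2⟩
    have hVS' : ∀ {O : Finset α} {y : α}, y ∈ V \ S → y ∉ O → y ∈ V \ (S ∪ O) := by
      intro O y hy hyO
      simp only [Finset.mem_sdiff, Finset.mem_union, not_or] at hy ⊢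
      exact ⟨hy.1, hy.2, hyO⟩
    have hrest_le : (V \ S) \ A ⊆ outerEnds a b m I (V \ S) E A := by
      intro z hz
      obtain ⟨hzW, hzA⟩ := Finset.mem_sdiff.1 hz
      by_contra hzo
      have h1 := hG.two_mul_le ht hV (T := S ∪ outerEnds a b m I (V \ S) E A)
        (Finset.union_subset hS (hout A)) (A := A)
        (B := (V \ (S ∪ outerEnds a b m I (V \ S) E A)) \ A) (hne A hA)
        ⟨z, Finset.mem_sdiff.2 ⟨hVS' hzW hzo, hzA⟩⟩
        (fun x hx => hVS' (hAW hx) (hoA A hA x hx)) Finset.sdiff_subset Finset.disjoint_sdiff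
        (by
          intro x hx y hy hadj
          by_contra hyA
          exact (hVS hy).2 (h.mem_ends_of_adj hA hx (hVS hy).1 hyA hadj).1)
        (by
          intro x hx y hy hadj
          obtain ⟨hx1, hx2⟩ := Finset.mem_sdiff.1 hx
          refine Finset.mem_sdiff.2 ⟨hy, fun hyA => ?_⟩
          exact (hVS hx1).2 (h.mem_ends_of_adj hA hyA (hVS hx1).1 hx2 hadj.symm).1)
      have h2 := hcardle _ (card_outerEnds_le A)
      linarith
    have hA_le : A ⊆ innerEnds a b m I (V \ S) E A := by
      intro z hz
      by_contra hzo
      have h1 := hG.two_mul_le ht hV (T := S ∪ (innerEnds a b m I (V \ S) E A ∩ A))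
        (Finset.union_subset hS (Finset.inter_subset_right.trans
          (hAW.trans Finset.sdiff_subset)))
        (A := A \ innerEnds a b m I (V \ S) E A) (B := (V \ S) \ A)
        ⟨z, Finset.mem_sdiff.2 ⟨hz, hzo⟩⟩ hrest
        (fun x hx => hVS' (hAW (Finset.mem_sdiff.1 hx).1)
          fun hx' => (Finset.mem_sdiff.1 hx).2 (Finset.mem_inter.1 hx').1)
        (fun x hx => hVS' (Finset.mem_sdiff.1 hx).1
          fun hx' => (Finset.mem_sdiff.1 hx).2 (Finset.mem_inter.1 hx').2)
        (Finset.disjoint_left.2 fun x hx hx' =>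
          (Finset.mem_sdiff.1 hx').2 (Finset.mem_sdiff.1 hx).1)
        (by
          intro x hx y hy hadj
          obtain ⟨hx1, hx2⟩ := Finset.mem_sdiff.1 hx
          have hyA : y ∈ A := by
            by_contra hyA
            exact hx2 (h.mem_ends_of_adj hA hx1 (hVS hy).1 hyA hadj).2
          exact Finset.mem_sdiff.2 ⟨hyA, fun hyi => (hVS hy).2 (Finset.mem_inter.2 ⟨hyi, hyA⟩)⟩)
        (by
          intro x hx y hy hadj
          obtain ⟨hx1, hx2⟩ := Finset.mem_sdiff.1 hx
          refine Finset.mem_sdiff.2 ⟨(hVS hy).1, fun hyA => ?_⟩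
          exact (hVS hy).2 (Finset.mem_inter.2
            ⟨(h.mem_ends_of_adj hA hyA hx1 hx2 hadj.symm).2, hyA⟩))
      have h2 := hcardle (innerEnds a b m I (V \ S) E A ∩ A)
        ((Finset.card_le_card Finset.inter_subset_left).trans (card_innerEnds_le A))
      linarith
    have h1 := (Finset.card_le_card hrest_le).trans (card_outerEnds_le A)
    have h2 := (Finset.card_le_card hA_le).trans (card_innerEnds_le A)
    have h3 := Finset.card_sdiff_add_card_eq_card hAW
    have h4 := Finset.card_sdiff_add_card_eq_card hS
    have h5 : V.card ≤ S.card + 2 * d A := by simp only [hd]; omega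
    have h6 : (V.card : ℝ) ≤ S.card + 2 * d A := by exact_mod_cast h5
    linarith
  -- By independence no outer end lies in a member of `J`. So the deleted set separates these parts,
  -- although it has at most |S| + ∑ d(A) < t|J| vertices.
  · have h1 := hG.mul_card_le ht hV (T := S ∪ J.biUnion (outerEnds a b m I (V \ S) E))
      (Finset.union_subset hS (Finset.biUnion_subset.2 fun A _ => hout A)) J hJ2
      (fun A hA => hne A (hJP hA))
      (by
        intro A hA x hx
        have hxW := hsub A (hJP hA) hx
        refine Finset.mem_sdiff.2 ⟨(Finset.mem_sdiff.1 hxW).1, fun hxT => ?_⟩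
        rcases Finset.mem_union.1 hxT with hxS | hxo
        · exact (Finset.mem_sdiff.1 hxW).2 hxS
        · obtain ⟨B, hB, hxB⟩ := Finset.mem_biUnion.1 hxo
          obtain ⟨-, h2, h3⟩ := h.mem_outerEnds hxB
          rw [h.sparse.part_eq_of_mem_parts (hJP hA) hx] at h2 h3
          exact hind B hB A hA h2.symm h3)
      (fun A hA B hB hAB => h.sparse.parts_disjoint (hJP hA) (hJP hB) hAB)
      (by
        intro A hA x hx y hy hadj
        by_contra hyA
        simp only [Finset.mem_sdiff, Finset.mem_union, not_or] at hy
        refine hy.2.2 (Finset.mem_biUnion.2 ⟨A, hA, ?_⟩)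
        exact (h.mem_ends_of_adj (hJP hA) hx (Finset.mem_sdiff.2 ⟨hy.1, hy.2.1⟩) hyA hadj).1)
    have h2 : (S ∪ J.biUnion (outerEnds a b m I (V \ S) E)).card ≤ S.card + ∑ A ∈ J, d A := by
      refine (Finset.card_union_le _ _).trans ?_
      gcongr
      exact Finset.card_biUnion_le.trans (Finset.sum_le_sum fun A _ => card_outerEnds_le A)
    have h3 : ((S ∪ J.biUnion (outerEnds a b m I (V \ S) E)).card : ℝ) ≤
        S.card + ∑ A ∈ J, (d A : ℝ) := by exact_mod_cast h2
    rw [Finset.sum_sub_distrib, Finset.sum_const, nsmul_eq_mul] at hJsum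
    linarith

/-- In a complete graph, many edges leave each part. -/
lemma card_le_card_boundary (hV : V(G) = V)
    (hK : ∀ x ∈ V(G), ∀ y ∈ V(G), x ≠ y → G.Adj x y)
    (h : IsSparseBasis m (G.deleteVerts (S : Set α)) a b (V \ S) E I)
    (hP : 2 ≤ (parts a b m I (V \ S)).card) {A : Finset α} (hA : A ∈ parts a b m I (V \ S)) :
    (V \ S).card ≤ (boundary a b m I (V \ S) E A).card + 1 := by
  have hAW := (h.sparse.parts_spec hA).2
  have hmul : A.card * ((V \ S) \ A).card ≤ (boundary a b m I (V \ S) E A).card := by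
    rw [← Finset.card_product]
    refine (Finset.card_le_card (t := (boundary a b m I (V \ S) E A).image fun e =>
      if part a b m I (V \ S) (a e) = A then (a e, b e) else (b e, a e)) ?_).trans
      Finset.card_image_le
    rintro ⟨x, y⟩ hp
    obtain ⟨hx, h2⟩ := Finset.mem_product.1 hp
    obtain ⟨h3, h4⟩ := Finset.mem_sdiff.1 (hAW hx)
    obtain ⟨h5, hy⟩ := Finset.mem_sdiff.1 h2
    obtain ⟨h7, h8⟩ := Finset.mem_sdiff.1 h5
    obtain ⟨e, he⟩ := hK x (by rw [hV]; exact h3) y (by rw [hV]; exact h7) fun h9 => hy (h9 ▸ hx)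
    have he' : (G.deleteVerts (S : Set α)).IsLink e x y := (deleteVerts_isLink _ _).2 ⟨he, h4, h8⟩
    refine Finset.mem_image.2 ⟨e, (h.mem_boundary hA he' hx hy).1, ?_⟩
    have hpx : part a b m I (V \ S) x = A := h.sparse.part_eq_of_mem_parts hA hx
    have hpy : part a b m I (V \ S) y ≠ A := fun h' => hy (h' ▸ (h.sparse.part_spec h5).2.1)
    rcases (h.hasEnds e he'.edge_mem).eq_and_eq_or_eq_and_eq he' with ⟨h1, h2⟩ | ⟨h1, h2⟩
    · rw [if_pos (by rw [h1, hpx]), h1, h2]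
    · rw [if_neg (by rw [h1]; exact hpy), h1, h2]
  have h1 : 1 ≤ A.card := (h.sparse.parts_spec hA).1.1.card_pos
  have h2 : 1 ≤ ((V \ S) \ A).card := by
    obtain ⟨B, hB, hBA⟩ := Finset.exists_mem_ne (by omega : 1 < (parts a b m I (V \ S)).card) A
    obtain ⟨x, hx⟩ := (h.sparse.parts_spec hB).1.1
    exact Finset.card_pos.2 ⟨x, Finset.mem_sdiff.2 ⟨(h.sparse.parts_spec hB).2 hx,
      Finset.disjoint_left.1 (h.sparse.parts_disjoint hB hA hBA) hx⟩⟩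
  have h3 := Finset.card_sdiff_add_card_eq_card hAW
  -- A product of two integers that are at least 1 is at least their sum minus 1.
  nlinarith

/-- The bound for strong toughness in a complete graph. -/
lemma le_card_of_complete (hV : V(G) = V) (hK : ∀ x ∈ V(G), ∀ y ∈ V(G), x ≠ y → G.Adj x y)
    (hS : S ⊆ V) (hcard : ((m : ℝ) ^ 2 + 3 * m + 2) / 2 ≤ V.card)
    (h : IsSparseBasis m (G.deleteVerts (S : Set α)) a b (V \ S) E I)
    (hP : 2 ≤ (parts a b m I (V \ S)).card) :
    (m : ℝ) * (parts a b m I (V \ S)).card -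
      (E.filter fun e => part a b m I (V \ S) (a e) ≠ part a b m I (V \ S) (b e)).card ≤
      S.card := by
  have h1 : (parts a b m I (V \ S)).card * (V \ S).card ≤
      2 * (E.filter fun e => part a b m I (V \ S) (a e) ≠ part a b m I (V \ S) (b e)).card +
        (parts a b m I (V \ S)).card := by
    rw [← h.sum_card_boundary, ← smul_eq_mul, ← Finset.sum_const]
    refine (Finset.sum_le_sum fun A hA => h.card_le_card_boundary hV hK hP hA).trans ?_
    simp [Finset.sum_add_distrib]
  have h2 : (parts a b m I (V \ S)).card ≤ (V \ S).card := Finset.card_image_le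
  have h3 := Finset.card_sdiff_add_card_eq_card hS
  have h4 : (m : ℝ) ^ 2 + 3 * m + 2 ≤ 2 * V.card := by linarith
  have h5 : m ^ 2 + 3 * m + 2 ≤ 2 * V.card := by exact_mod_cast h4
  generalize (parts a b m I (V \ S)).card = n at *
  generalize (E.filter fun e => part a b m I (V \ S) (a e) ≠ part a b m I (V \ S) (b e)).card = c
    at *
  generalize (V \ S).card = N at *
  suffices h6 : m * n ≤ S.card + c by
    have h7 : (m : ℝ) * n ≤ S.card + c := by exact_mod_cast h6
    linarith
  rw [← h3] at h5
  zify at *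
  -- Inserting 2c ≥ n(N - 1), the bound on |V| and N ≥ n ≥ 2 reduces the claim to n² - (2m + 3)n +
  -- (m + 1)(m + 2) ≥ 0. This is a product of consecutive integers, and explains the bound (m + 1)(m
  -- + 2)/2 on |V|.
  have h8 : 0 ≤ ((n : ℤ) - m - 1) * (n - m - 2) := by
    rcases le_or_gt (n : ℤ) (m + 1) with h9 | h9 <;> nlinarith
  nlinarith [mul_nonneg (sub_nonneg.2 h2) (sub_nonneg.2 hP)]

end IsSparseBasis

/-- A tough graph is strongly tough if it has at least two nonadjacent vertices or if it has
sufficiently many vertices. -/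
theorem IsTough.isStronglyTough (hm : 1 ≤ m) (hVf : V(G).Finite) (hEf : E(G).Finite)
    (hG : IsTough ((m : ℝ) ^ 2 + m - 1) G)
    (hcard : ((m : ℝ) ^ 2 + 3 * m + 2) / 2 ≤ V(G).ncard ∨
      ¬ ∀ x ∈ V(G), ∀ y ∈ V(G), x ≠ y → G.Adj x y) : IsStronglyTough m (m : ℝ) G := by
  have hm' : (1 : ℝ) ≤ m := by exact_mod_cast hm
  have ht : (0 : ℝ) < (m : ℝ) ^ 2 + m - 1 := by nlinarith
  obtain ⟨V, hV⟩ := hVf.exists_finset_coe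
  obtain ⟨E, hE⟩ := hEf.exists_finset_coe
  rw [← hV, Set.ncard_coe_finset] at hcard
  have hne : V(G).Nonempty := by
    rcases hcard with hcard | hcard
    · rw [← hV, Finset.coe_nonempty, ← Finset.card_pos]
      have : (0 : ℝ) < V.card := by nlinarith
      exact_mod_cast this
    · push Not at hcard
      obtain ⟨x, hx, -⟩ := hcard
      exact ⟨x, hV ▸ hx⟩
  obtain ⟨a, b, h⟩ := exists_hasEnds hne
  intro S hSV
  rw [← hV] at hSV
  lift S to Finset α using V.finite_toSet.subset hSV
  have hS : S ⊆ V := by exact_mod_cast hSV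
  obtain ⟨I, hI⟩ := exists_isSparseBasis m (h.of_le (deleteVerts_le (X := (S : Set α))))
    (V := V \ S) (by rw [vertexSet_deleteVerts, ← hV, Finset.coe_sdiff])
    (h.edgeSet_deleteVerts hV.symm hE.symm S)
  rw [Omega, hI.ncard_treeComponentSets hm, hI.ncard_crossingEdges hm, Set.ncard_coe_finset]
  rcases Nat.lt_or_ge (parts a b m I (V \ S)).card 2 with hlt | hP
  · refine le_max_of_le_left ?_
    have h1 : ((parts a b m I (V \ S)).card : ℝ) ≤ 1 := by exact_mod_cast Nat.lt_succ_iff.1 hlt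
    have h2 : (0 : ℝ) ≤ 1 / (m : ℝ) * (((inside a b E (V \ S)).filter
      fun e => part a b m I (V \ S) (a e) ≠ part a b m I (V \ S) (b e)).card : ℝ) := by positivity
    linarith
  · refine le_max_of_le_right ?_
    have key : (m : ℝ) * (parts a b m I (V \ S)).card -
        ((inside a b E (V \ S)).filter
          fun e => part a b m I (V \ S) (a e) ≠ part a b m I (V \ S) (b e)).card ≤ S.card := by
      by_cases hK : ∀ x ∈ V(G), ∀ y ∈ V(G), x ≠ y → G.Adj x y
      · refine hI.le_card_of_complete hV.symm hK hS (hcard.resolve_right ?_) hP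
        rw [hV]
        exact fun hn => hn hK
      · refine hI.le_card_of_tough hm hG hV.symm hS ?_ hP
        push Not at hK
        obtain ⟨x, hx, y, hy, hxy, hadj⟩ := hK
        rw [← hV] at hx hy
        exact hG.two_mul_add_two_le ht hV.symm hx hy hxy hadj
    rw [one_div, inv_mul_eq_div, inv_mul_eq_div, le_div_iff₀ (by linarith), sub_mul,
      div_mul_cancel₀ _ (by linarith)]
    linarith

end Graph

end

theorem mainTheorem7 {α β : Type*} (m : ℕ) (hm : 1 ≤ m) (G : Graph α β)
    (hloop : G.Loopless) (hV : G.vertexSet.Finite) (hE : G.edgeSet.Finite)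
    (htough : Graph.IsTough ((m : ℝ) ^ 2 + m - 1) G) :
    (((m : ℝ) ^ 2 + 3 * m + 2) / 2 ≤ (G.vertexSet.ncard : ℝ) →
      Graph.IsStronglyTough m (m : ℝ) G) ∧
    (2 * m ≤ G.vertexSet.ncard →
      ∃ H : Graph α β, H ≤s G ∧ Graph.IsTreeConnected m H ∧
        ∀ v ∈ H.vertexSet, H.edgeDegree v ≤ 2 * m + 1) := by
  refine ⟨fun h => htough.isStronglyTough hm hV hE (Or.inl h), fun hn => ?_⟩
  -- A complete graph may be too small for the first statement and needs its own construction; in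
  -- any other graph toughness itself provides enough vertices.
  by_cases hK : ∀ x ∈ G.vertexSet, ∀ y ∈ G.vertexSet, x ≠ y → G.Adj x y
  · obtain ⟨H, hH, hT, hd⟩ := Graph.exists_isTreeConnected_of_complete hm hV hE hK hn
    exact ⟨H, hH, hT, fun v hv => (hd v hv).trans (Nat.le_succ _)⟩
  · refine (htough.isStronglyTough hm hV hE (Or.inr hK)).exists_isTreeConnected hm hloop hV hE ?_
    exact Set.nonempty_of_ncard_ne_zero (by omega)
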